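/- Let $(R,\mathfrak m,k)$ be a one-dimensional Noetherian local domain with infinite residue field $k$ and fraction field $K$, such that the integral closure $\overline R$ of $R$ in $K$ is a finite $R$-module and a discrete valuation ring with normalized valuation $v$, and such that the natural map from $k$ to the residue field of $\overline R$ is an isomorphism. Write $\ell=\ell_R$ for length, $I:J=\{x\in K\mid xJ\subseteq I\}$ and $I^*=R:I$ for fractional ideals, and $v(J)=\{v(y)\mid 0\ne y\in J\}$. A canonical module of $R$ is a nonzero fractional ideal $\omega$ with $\omega:(\omega:J)=J$ for all nonzero fractional ideals $J$; $R$ is Gorenstein if $R$ is a canonical module of itself. Let $\Lambda=\bigcup_{n\ge 0}(\mathfrak m^n:\mathfrak m^n)$ be the blowing-up of $R$ along $\mathfrak m$. Let $e=h(1)$ be the multiplicity of $R$, where $h\in\mathbb Z[z]$ is the polynomial with $\sum_{n\ge 0}\ell(\mathfrak m^n/\mathfrak m^{n+1})z^n=h(z)/(1-z)$; let $\mu=\dim_k\mathfrak m/\mathfrak m^2$; and let $\nu$ be the reduction exponent of $\mathfrak m$, i.e. the least integer $\nu$ such that for some $x\in\mathfrak m$ one has $\mathfrak m^{n+1}=x\,\mathfrak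 m^n$ for all $n\ge\nu$. Put $\gamma=R:\overline R$, $c=\ell(\overline R/\gamma)$, $\delta=\ell(\overline R/R)$, $n=c-\delta=\ell(R/\gamma)$. Let $0=s_0<s_1<s_2<\cdots$ be the elements of $v(R)$, let $R_i=\{a\in R\mid v(a)\ge s_i\}$, and let $r_i=\ell\big((R:R_i)/(R:R_{i-1})\big)$ for $1\le i\le n$ (the type sequence of $R$). $R$ is almost Gorenstein if $r_1-1=2\delta-c$. Put $\Gamma=\{i\in\{1,\dots,n\}\mid s_{i-1}\in v(R:\Lambda)\}$ and $d(R:\Lambda)=\ell(\overline R/\Lambda^{**})-\sum_{i\in\Gamma}r_i$. Suppose $e=\mu+1$. Then: (1) $R:\Lambda=\mathfrak m^\nu$ if and only if $R$ is Gorenstein and $\nu=2$. (2) $\displaystyle\sum_{1\le i\le n,\ i\notin\Gamma,\ i\ne 1}(r_i-1)=d(R:\Lambda)+\ell(\Lambda^{**}/\Lambda)+(\nu-2)$. (3) For every canonical module $\omega$ of $R$ with $R\subseteq\omega\subseteq\overline R$: $R$ is almost Gorenstein if and only if $\nu=2$ and $\omega\Lambda=\Lambda$. -/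

import Mathlib

noncomputable section

namespace CurveSing

open IsLocalRing

section General

variable {R : Type*} [CommRing R]

/-- The length `ℓ_R(A / B)` of the quotient of two submodules `B ⊆ A`, as a natural number
(it is only used below for quotients of finite length). -/
def len {M : Type*} [AddCommGroup M] [Module R M] (A B : Submodule R M) : ℕ :=
  (Module.length R (A ⧸ B.submoduleOf A)).toNat

/-- The Hilbert function `H_I(n) = ℓ_R(I^n / I^(n+1))`. -/
def hilbertFun (I : Ideal R) (n : ℕ) : ℕ := len (I ^ n) (I ^ (n + 1))

/-- The Hilbert-Poincaré series `P_I(z) = ∑ H_I(n) z^n`. -/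
def hilbertSeries (I : Ideal R) : PowerSeries ℤ :=
  PowerSeries.mk fun n => (hilbertFun I n : ℤ)

open Classical in
/-- The `h`-polynomial of `I`: the (unique) polynomial `h` with `P_I(z) = h(z) / (1 - z)`. -/
def hPoly (I : Ideal R) : Polynomial ℤ :=
  if h : ∃ p : Polynomial ℤ,
      (p : PowerSeries ℤ) = (1 - (PowerSeries.X : PowerSeries ℤ)) * hilbertSeries I
    then h.choose else 0

/-- The multiplicity `e(I) = h_I(1)`. -/
def mult (I : Ideal R) : ℤ := (hPoly I).eval 1

/-- The reduction exponent `ν(I)`: the least `k` such that, for some `x ∈ I`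
(a minimal reduction of `I`), `I^(n+1) = x I^n` for all `n ≥ k`. -/
def reductionExponent (I : Ideal R) : ℕ :=
  sInf {k : ℕ | ∃ x ∈ I, ∀ n ≥ k, I ^ (n + 1) = Ideal.span {x} * I ^ n}

/-- The embedding dimension `μ = dim_k 𝔪/𝔪²`. -/
def embDim (R : Type*) [CommRing R] [IsLocalRing R] : ℕ :=
  Module.finrank (ResidueField R) (CotangentSpace R)

end General

/-! Fractional ideals of `R` are regarded as `R`-submodules of the fraction field `K`.
For submodules, `I / J` is Mathlib's colon `{x ∈ K | x J ⊆ I}`, and `1` is the image of `R`. -/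

section Fractional

variable {R : Type*} [CommRing R] (K : Type*) [Field K] [Algebra R K]

/-- The integral closure of `R` in `K`, as an `R`-submodule of `K`. -/
def Rbar (R : Type*) [CommRing R] (K : Type*) [Field K] [Algebra R K] : Submodule R K :=
  Subalgebra.toSubmodule (integralClosure R K)

/-- An ideal of `R` as an `R`-submodule of `K`. -/
def frac (I : Ideal R) : Submodule R K := IsLocalization.coeSubmodule K I

/-- The blowing-up `Λ(I) = ⋃ₙ (Iⁿ : Iⁿ)`; the union is increasing, so it is the supremum. -/
def blowup (I : Ideal R) : Submodule R K := ⨆ n : ℕ, (frac K I ^ n) / (frac K I ^ n)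

variable {K}

/-- The dual `I^* = R : I`. -/
def dual (I : Submodule R K) : Submodule R K := 1 / I

/-- `ω` is a canonical module of `R`, realized as a fractional ideal: a nonzero fractional ideal
with `ω : (ω : I) = I` for every nonzero fractional ideal `I`. -/
def IsCanonicalIdeal (ω : Submodule R K) : Prop :=
  ω ≠ ⊥ ∧ ω.FG ∧ ∀ I : Submodule R K, I ≠ ⊥ → I.FG → ω / (ω / I) = I

/-- `R` is Gorenstein: `R` is a canonical module of itself. -/
def IsGorenstein (R : Type*) [CommRing R] (K : Type*) [Field K] [Algebra R K] : Prop :=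
  IsCanonicalIdeal (1 : Submodule R K)

end Fractional

section Invariants

variable (R : Type*) [CommRing R] (K : Type*) [Field K] [Algebra R K]

/-- The conductor ideal `γ_R = R : R̄`. -/
def condIdeal : Submodule R K := 1 / Rbar R K

/-- `c = ℓ_R(R̄ / γ_R)`. -/
def cond : ℕ := len (Rbar R K) (condIdeal R K)

/-- The singularity degree `δ = ℓ_R(R̄ / R)`. -/
def delta : ℕ := len (Rbar R K) 1

/-- `n = c - δ = ℓ_R(R / γ_R)`, the length of the type sequence. -/
def numTS : ℕ := len 1 (condIdeal R K)

/-- `R` is residually rational: the natural map from the residue field of `R` to that of the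
integral closure is an isomorphism (equivalently, surjective after composing with `R → k`). -/
def ResiduallyRational [IsLocalRing (integralClosure R K)] : Prop :=
  Function.Surjective
    ((residue (integralClosure R K)).comp (algebraMap R (integralClosure R K)))

variable [IsDiscreteValuationRing (integralClosure R K)]

variable {R K} in
/-- The set of values `v(M)` of the nonzero elements of `M`, for an `R`-submodule `M` of the
integral closure, where `v` is the normalized valuation of the integral closure. -/
def values (M : Submodule R K) : Set ℕ :=
  {n | ∃ y : integralClosure R K, (y : K) ∈ M ∧
    IsDiscreteValuationRing.addVal (integralClosure R K) y = (n : ℕ∞)}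

/-- `s_i`, where `s_0 = 0 < s_1 < s_2 < ⋯` are the elements of the semigroup `v(R)`. -/
def sElem (i : ℕ) : ℕ := Nat.nth (fun a => a ∈ values (1 : Submodule R K)) i

/-- The ideal `R_i = {a ∈ R | v(a) ≥ s_i}`. -/
def idealR (i : ℕ) : Ideal R where
  carrier := {a | (sElem R K i : ℕ∞) ≤
    IsDiscreteValuationRing.addVal (integralClosure R K) (algebraMap R (integralClosure R K) a)}
  add_mem' {a b} ha hb := by
    simp only [Set.mem_ofPred_eq, map_add] at ha hb ⊢
    exact le_trans (le_min ha hb) (IsDiscreteValuationRing.addVal_add)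
  zero_mem' := by simp
  smul_mem' r a ha := by
    simp only [Set.mem_ofPred_eq, smul_eq_mul, map_mul,
      IsDiscreteValuationRing.addVal_mul] at ha ⊢
    exact le_trans ha le_add_self

/-- The type sequence: `r_i = ℓ_R((R : R_i) / (R : R_{i-1}))`, for `i = 1, …, n`. -/
def typeSeq (i : ℕ) : ℕ :=
  len (dual (frac K (idealR R K i))) (dual (frac K (idealR R K (i - 1))))

/-- `R` is almost Gorenstein: `r_1 - 1 = 2 δ - c`. -/
def IsAlmostGorenstein : Prop :=
  (typeSeq R K 1 : ℤ) - 1 = 2 * (delta R K : ℤ) - (cond R K : ℤ)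

variable {R}

open Classical in
/-- `Γ = {i ∈ {1, …, n} | s_{i-1} ∈ v(R : Λ)}`, where `Λ = Λ(I)`. -/
def Gam (I : Ideal R) : Finset ℕ :=
  (Finset.Icc 1 (numTS R K)).filter fun i => sElem R K (i - 1) ∈ values (dual (blowup K I))

/-- `d(R : Λ) = ℓ_R(R̄ / Λ^**) - ∑_{i ∈ Γ} r_i`, where `Λ = Λ(I)`. -/
def dInv (I : Ideal R) : ℤ :=
  (len (Rbar R K) (dual (dual (blowup K I))) : ℤ) - ∑ i ∈ Gam K I, (typeSeq R K i : ℤ)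

end Invariants

end CurveSing

end

/-! Write V for the integral closure, and let x ∈ 𝔪 have least value. All fractional ideals are
compared with the chain R ⊆ N ⊆ N² ⊆ … ⊆ V, where N = x⁻¹𝔪. It becomes stationary exactly at N^ν =
Λ. Since ℓ(A/xA) does not depend on A, H(n) + ℓ(N^(n+1)/N^n) = ℓ(R/xR) for all n, so e = ℓ(R/xR) and
e = μ + 1 says precisely that N²/N is simple (`covBy_of_mult_eq`).

Simplicity has two consequences. First, every later quotient N^(n+2)/N^(n+1) has length at most one
(`qlen_pow_succ_le_one`), whence ℓ(Λ/R) = e + ν - 2 (`len_blowup_one`). Second, an element of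
positive value in R : 𝔪 = 𝔪 : 𝔪 acts on N²/N nilpotently, hence by zero. So these elements form a
Λ-stable submodule B₊ of R : 𝔪, of colength one by residual rationality, and R : Λ = xB₊
(`dual_blowup_eq`). With r = ℓ((R : 𝔪)/R) this gives ℓ(R/(R : Λ)) = e - r + 1
(`len_one_dual_blowup`).

The three assertions are then length counts. For (1), 𝔪^ν ⊆ R : Λ and ℓ(R/𝔪²) = e, so equality
forces r = 1, which is the Gorenstein property (`isGorenstein_of_len_dual_eq_one`), and 𝔪^ν = 𝔪².
For (2), the r_i sum to δ, Γ has n - ℓ(R/(R : Λ)) elements, and r₁ = r. For (3), duality into ω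
turns almost Gorensteinness into r = ℓ(ω/R) + 1, equivalently 𝔪ω = 𝔪; this yields ωΛ = Λ, and once
ωΛ = Λ holds the two length formulas reduce the condition to ν = 2. -/

noncomputable section

namespace CurveSing

open IsLocalRing

/-! ### Lengths of quotients of submodules -/

section Length

variable {R : Type*} [CommRing R] {M : Type*} [AddCommGroup M] [Module R M]

/-- The length of `A / B`, with values in `ℕ∞`. -/
def qlen (A B : Submodule R M) : ℕ∞ := Module.length R (A ⧸ B.submoduleOf A)

theorem len_eq_toNat_qlen (A B : Submodule R M) : len A B = (qlen A B).toNat := rfl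

/-- Submodules of `A` above `B` correspond to the interval `[B, A]`. -/
def iciSubmoduleOfOrderIso {A B : Submodule R M} (h : B ≤ A) :
    Set.Ici (B.submoduleOf A) ≃o Set.Icc B A where
  toFun p := ⟨p.1.map A.subtype, by
    have h1 := Submodule.map_mono (f := A.subtype) p.2
    have h2 : (B.submoduleOf A).map A.subtype = B := by
      simp only [Submodule.submoduleOf, Submodule.map_comap_subtype, inf_eq_right.2 h]
    rw [h2] at h1
    exact ⟨h1, Submodule.map_subtype_le _ _⟩⟩
  invFun q := ⟨q.1.comap A.subtype, Submodule.comap_mono q.2.1⟩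
  left_inv p := Subtype.ext (Submodule.comap_map_eq_of_injective A.injective_subtype _)
  right_inv q := Subtype.ext (by
    simp [Submodule.map_comap_subtype, inf_eq_right.2 q.2.2])
  map_rel_iff' {p q} := by
    exact Submodule.map_le_map_iff_of_injective A.injective_subtype p.1 q.1

/-- Length depends only on the order of the interval [B, A]. This lets it be transported along maps
that are merely order-theoretic, such as the order-reversing I ↦ ω : I. -/
theorem coe_qlen {A B : Submodule R M} (h : B ≤ A) :
    (qlen A B : WithBot ℕ∞) = Order.krullDim (Set.Icc B A) := by
  rw [qlen, Module.coe_length, Order.krullDim_eq_of_orderIso (Submodule.comapMkQRelIso _),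
    Order.krullDim_eq_of_orderIso (iciSubmoduleOfOrderIso h)]

theorem qlen_add {A B C : Submodule R M} (hBA : B ≤ A) (hCB : C ≤ B) :
    qlen A C = qlen A B + qlen B C := by
  rw [add_comm]
  let f : (B ⧸ C.submoduleOf B) →ₗ[R] (A ⧸ C.submoduleOf A) :=
    Submodule.mapQ _ _ (Submodule.inclusion hBA) (fun x hx => hx)
  let g : (A ⧸ C.submoduleOf A) →ₗ[R] (A ⧸ B.submoduleOf A) :=
    Submodule.factor (fun x hx => hCB hx)
  refine Module.length_eq_add_of_exact f g ?_ (Submodule.factor_surjective _) ?_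
  · rw [← LinearMap.ker_eq_bot, LinearMap.ker_eq_bot']
    intro x hx
    induction x using Submodule.Quotient.induction_on with | _ x
    exact (Submodule.Quotient.mk_eq_zero _).2 ((Submodule.Quotient.mk_eq_zero _).1 hx :
      Submodule.inclusion hBA x ∈ C.submoduleOf A)
  · intro x
    induction x using Submodule.Quotient.induction_on with | _ x
    constructor
    · intro hx
      have hx' : x ∈ B.submoduleOf A := by
        rw [← Submodule.Quotient.mk_eq_zero]; exact hx
      exact ⟨Submodule.Quotient.mk ⟨x.1, hx'⟩, rfl⟩
    · rintro ⟨y, hy⟩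
      induction y using Submodule.Quotient.induction_on with | _ y
      rw [← hy]
      exact (Submodule.Quotient.mk_eq_zero _).2 y.2

theorem qlen_map {N : Type*} [AddCommGroup N] [Module R N] (f : M →ₗ[R] N)
    (hf : Function.Injective f) {A B : Submodule R M} (h : B ≤ A) :
    qlen (A.map f) (B.map f) = qlen A B := by
  apply WithBot.coe_injective
  rw [coe_qlen h, coe_qlen (Submodule.map_mono h)]
  let e : Set.Icc B A ≃o Set.Icc (B.map f) (A.map f) :=
    { toFun := fun p => ⟨p.1.map f, Submodule.map_mono p.2.1, Submodule.map_mono p.2.2⟩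
      invFun := fun q => ⟨q.1.comap f, Submodule.map_le_iff_le_comap.1 q.2.1, by
        have := Submodule.comap_mono (f := f) q.2.2
        rwa [Submodule.comap_map_eq_of_injective hf] at this⟩
      left_inv := fun p => Subtype.ext (Submodule.comap_map_eq_of_injective hf _)
      right_inv := fun q => Subtype.ext (by
        change Submodule.map f (Submodule.comap f q.1) = q.1
        rw [Submodule.map_comap_eq, inf_eq_right]
        exact q.2.2.trans LinearMap.map_le_range)
      map_rel_iff' := fun {p q} => Submodule.map_le_map_iff_of_injective hf p.1 q.1 }
  exact (Order.krullDim_eq_of_orderIso e).symm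

theorem len_map {N : Type*} [AddCommGroup N] [Module R N] (f : M →ₗ[R] N)
    (hf : Function.Injective f) {A B : Submodule R M} (h : B ≤ A) :
    len (A.map f) (B.map f) = len A B := by
  rw [len_eq_toNat_qlen, len_eq_toNat_qlen, qlen_map f hf h]

theorem qlen_eq_zero_iff {A B : Submodule R M} : qlen A B = 0 ↔ A ≤ B := by
  rw [qlen, Module.length_eq_zero_iff, Submodule.Quotient.subsingleton_iff,
    Submodule.submoduleOf_eq_top]

theorem len_self (A : Submodule R M) : len A A = 0 := by
  rw [len_eq_toNat_qlen, qlen_eq_zero_iff.2 le_rfl]; rfl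

theorem qlen_eq_one_iff {A B : Submodule R M} (h : B ≤ A) : qlen A B = 1 ↔ B ⋖ A := by
  rw [qlen, Module.length_eq_one_iff, covBy_iff_quot_is_simple h]; rfl

variable [IsLocalRing R]

/-- A simple module over a local ring is killed by the maximal ideal: if r x generated A/B, then x =
s r x modulo B with 1 - s r a unit. -/
theorem smul_mem_of_covBy {A B : Submodule R M} (h : B ⋖ A) {r : R} (hr : r ∈ maximalIdeal R)
    {x : M} (hx : x ∈ A) : r • x ∈ B := by
  by_contra hcon
  have hlt : B < B ⊔ Submodule.span R {r • x} :=
    lt_of_le_of_ne le_sup_left fun he => hcon (he ▸ Submodule.mem_sup_right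
      (Submodule.mem_span_singleton_self _))
  have hle : B ⊔ Submodule.span R {r • x} ≤ A :=
    sup_le h.1.le ((Submodule.span_singleton_le_iff_mem _ _).2 (A.smul_mem _ hx))
  have heq : B ⊔ Submodule.span R {r • x} = A :=
    (h.eq_or_eq hlt.le hle).resolve_left hlt.ne'
  rw [← heq, Submodule.mem_sup] at hx
  obtain ⟨b, hb, z, hz, hbz⟩ := hx
  obtain ⟨s, rfl⟩ := Submodule.mem_span_singleton.1 hz
  have hu : IsUnit (1 - s * r) := by
    by_contra hn
    have h1 : s * r ∈ maximalIdeal R := Ideal.mul_mem_left _ _ hr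
    exact (Ideal.ne_top_iff_one _).1 (maximalIdeal.isMaximal R).ne_top
      (by simpa using add_mem ((mem_maximalIdeal _).2 hn) h1)
  have hbx : (1 - s * r) • x = b := by
    rw [sub_smul, one_smul, mul_smul, sub_eq_iff_eq_add]
    exact hbz.symm
  obtain ⟨u, hu⟩ := hu
  apply hcon
  have : x = (↑u⁻¹ : R) • b := by
    rw [← hbx, ← hu, smul_smul, Units.inv_mul, one_smul]
  rw [this]
  exact B.smul_mem _ (B.smul_mem _ hb)

/-- Adding to `B` one generator killed by the maximal ideal increases the length by at most one. -/
theorem qlen_sup_span_singleton_le_one {B : Submodule R M} {y : M}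
    (hy : ∀ r ∈ maximalIdeal R, r • y ∈ B) : qlen (B ⊔ Submodule.span R {y}) B ≤ 1 := by
  by_cases hyB : y ∈ B
  · rw [sup_eq_left.2 ((Submodule.span_singleton_le_iff_mem _ _).2 hyB),
      qlen_eq_zero_iff.2 le_rfl]
    exact zero_le
  refine ((qlen_eq_one_iff le_sup_left).2 ⟨lt_of_le_of_ne le_sup_left fun he =>
    hyB ((Submodule.span_singleton_le_iff_mem _ _).1 (sup_eq_left.1 he.symm)), ?_⟩).le
  intro C hBC hC
  obtain ⟨z, hzC, hzB⟩ := SetLike.exists_of_lt hBC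
  obtain ⟨b, hb, w, hw, rfl⟩ := Submodule.mem_sup.1 (hC.le hzC)
  obtain ⟨s, rfl⟩ := Submodule.mem_span_singleton.1 hw
  by_cases hs : IsUnit s
  · obtain ⟨u, rfl⟩ := hs
    have h1 : (u : R) • y ∈ C := by
      have := C.sub_mem hzC (hBC.le hb)
      rwa [add_sub_cancel_left] at this
    have h2 : y ∈ C := by
      have := C.smul_mem (↑u⁻¹ : R) h1
      rwa [smul_smul, Units.inv_mul, one_smul] at this
    exact hC.not_ge (sup_le hBC.le ((Submodule.span_singleton_le_iff_mem _ _).2 h2))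
  · exact hzB (B.add_mem hb (hy s ((mem_maximalIdeal _).2 hs)))

end Length

/-! ### Fractional ideals: colons, canonical duality, finiteness of length -/

section Fractional

variable {R : Type*} [CommRing R] {K : Type*} [Field K] [Algebra R K]

theorem span_singleton_mul_eq_map (x : K) (A : Submodule R K) :
    Submodule.span R {x} * A = A.map (LinearMap.mulLeft R x) := by
  ext y
  rw [Submodule.mem_span_singleton_mul, Submodule.mem_map]
  rfl

theorem span_singleton_mul_le_iff {x : K} (hx : x ≠ 0) {A B : Submodule R K} :
    Submodule.span R {x} * A ≤ Submodule.span R {x} * B ↔ A ≤ B := by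
  rw [span_singleton_mul_eq_map, span_singleton_mul_eq_map]
  exact Submodule.map_le_map_iff_of_injective (mul_right_injective₀ hx) A B

theorem span_singleton_inv_mul_cancel {x : K} (hx : x ≠ 0) :
    Submodule.span R {x⁻¹} * Submodule.span R {x} = 1 := by
  rw [Submodule.span_mul_span, Set.singleton_mul_singleton, inv_mul_cancel₀ hx,
    Submodule.one_eq_span]

theorem len_span_singleton_mul {x : K} (hx : x ≠ 0) {A B : Submodule R K} (h : B ≤ A) :
    len (Submodule.span R {x} * A) (Submodule.span R {x} * B) = len A B := by
  rw [span_singleton_mul_eq_map, span_singleton_mul_eq_map]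
  exact len_map _ (mul_right_injective₀ hx) h

theorem one_fg : (1 : Submodule R K).FG := by
  rw [Submodule.one_eq_span]; exact Submodule.fg_span_singleton _

theorem one_ne_bot : (1 : Submodule R K) ≠ ⊥ := by
  intro h
  have : (1 : K) ∈ (1 : Submodule R K) := Submodule.one_le.1 le_rfl
  rw [h, Submodule.mem_bot] at this
  exact one_ne_zero this

theorem ne_bot_of_le {A B : Submodule R K} (hB : B ≠ ⊥) (h : B ≤ A) : A ≠ ⊥ :=
  fun hA => hB (le_bot_iff.1 (hA ▸ h))

theorem div_mul_eq (A B C : Submodule R K) : A / (B * C) = A / B / C :=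
  eq_of_forall_le_iff fun D => by
    simp only [Submodule.le_div_iff_mul_le, mul_assoc, mul_comm B C]

theorem div_anti_right (A : Submodule R K) {B C : Submodule R K} (h : B ≤ C) : A / C ≤ A / B :=
  Submodule.le_div_iff_mul_le.2
    ((mul_le_mul_right h _).trans (Submodule.le_div_iff_mul_le.1 le_rfl))

theorem div_one_eq (A : Submodule R K) : A / 1 = A :=
  eq_of_forall_le_iff fun D => by rw [Submodule.le_div_iff_mul_le, mul_one]

theorem le_div_div (A B : Submodule R K) : B ≤ A / (A / B) := by
  rw [Submodule.le_div_iff_mul_le, mul_comm]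
  exact Submodule.le_div_iff_mul_le.1 le_rfl

theorem span_singleton_mul_div {x : K} (hx : x ≠ 0) (A B : Submodule R K) :
    A / (Submodule.span R {x⁻¹} * B) = Submodule.span R {x} * (A / B) := by
  ext y
  rw [Submodule.mem_div_iff_forall_mul_mem, Submodule.mem_span_singleton_mul]
  constructor
  · intro h
    refine ⟨x⁻¹ * y, ?_, by field_simp⟩
    rw [Submodule.mem_div_iff_forall_mul_mem]
    intro b hb
    have := h (x⁻¹ * b) (Submodule.mem_span_singleton_mul.2 ⟨b, hb, rfl⟩)
    rwa [mul_left_comm, ← mul_assoc] at this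
  · rintro ⟨z, hz, rfl⟩ w hw
    obtain ⟨b, hb, rfl⟩ := Submodule.mem_span_singleton_mul.1 hw
    have := Submodule.mem_div_iff_forall_mul_mem.1 hz b hb
    convert this using 1
    field_simp

theorem IsCanonicalIdeal.div_self {ω : Submodule R K} (hω : IsCanonicalIdeal ω) : ω / ω = 1 := by
  have := hω.2.2 1 one_ne_bot one_fg
  rwa [div_one_eq] at this

section Noetherian

variable [IsNoetherianRing R]

theorem fg_of_le {A B : Submodule R K} (hA : A.FG) (h : B ≤ A) : B.FG := by
  have : Module.Finite R A := Module.Finite.iff_fg.2 hA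
  have := isNoetherian_of_isNoetherianRing_of_finite R A
  exact isNoetherian_submodule.1 this B h

theorem div_fg {A B : Submodule R K} (hA : A.FG) (hB : B ≠ ⊥) : (A / B).FG := by
  obtain ⟨b, hb, hb0⟩ := Submodule.exists_mem_ne_zero_of_ne_bot hB
  refine fg_of_le (Submodule.FG.mul (Submodule.fg_span_singleton (R := R) b⁻¹) hA) fun y hy => ?_
  exact Submodule.mem_span_singleton_mul.2 ⟨y * b,
    Submodule.mem_div_iff_forall_mul_mem.1 hy b hb, by field_simp⟩

end Noetherian

variable [IsDomain R] [IsFractionRing R K]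

theorem exists_le_span_singleton {A : Submodule R K} (hA : A.FG) :
    ∃ y : K, y ≠ 0 ∧ A ≤ Submodule.span R {y} := by
  obtain ⟨a, ha, h⟩ := FractionalIdeal.isFractional_of_fg (S := nonZeroDivisors R) hA
  have ha0 : algebraMap R K a ≠ 0 :=
    IsFractionRing.to_map_ne_zero_of_mem_nonZeroDivisors ha
  refine ⟨(algebraMap R K a)⁻¹, inv_ne_zero ha0, fun b hb => ?_⟩
  obtain ⟨r, hr⟩ := h b hb
  refine Submodule.mem_span_singleton.2 ⟨r, ?_⟩
  rw [Algebra.smul_def, hr, Algebra.smul_def]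
  field_simp

theorem div_ne_bot {A B : Submodule R K} (hA : A ≠ ⊥) (hB : B.FG) : A / B ≠ ⊥ := by
  obtain ⟨y, hy0, hy⟩ := exists_le_span_singleton hB
  obtain ⟨a, ha, ha0⟩ := Submodule.exists_mem_ne_zero_of_ne_bot hA
  refine (Submodule.ne_bot_iff _).2 ⟨a * y⁻¹, ?_, mul_ne_zero ha0 (inv_ne_zero hy0)⟩
  rw [Submodule.mem_div_iff_forall_mul_mem]
  intro b hb
  obtain ⟨r, rfl⟩ := Submodule.mem_span_singleton.1 (hy hb)
  rw [Algebra.smul_def]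
  have : a * y⁻¹ * (algebraMap R K r * y) = r • a := by
    rw [Algebra.smul_def]; field_simp
  rw [this]
  exact A.smul_mem _ ha

variable [IsNoetherianRing R]

/-- A canonical ideal induces a length-preserving duality on fractional ideals. -/
theorem IsCanonicalIdeal.len_div_div {ω : Submodule R K} (hω : IsCanonicalIdeal ω)
    {I J : Submodule R K} (h : J ≤ I) (hI : I.FG) (hJ : J ≠ ⊥) :
    len (ω / J) (ω / I) = len I J := by
  obtain ⟨hω0, hωfg, hdual⟩ := hω
  have hJI : ω / I ≤ ω / J := div_anti_right _ h
  have hI0 : I ≠ ⊥ := ne_bot_of_le hJ h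
  rw [len_eq_toNat_qlen, len_eq_toNat_qlen]
  congr 1
  apply WithBot.coe_injective
  rw [coe_qlen h, coe_qlen hJI, ← Order.krullDim_orderDual (α := Set.Icc J I)]
  refine (Order.krullDim_eq_of_orderIso (α := (Set.Icc J I)ᵒᵈ)
    (β := Set.Icc (ω / I) (ω / J)) (RelIso.mk ⟨fun p => ⟨ω / (OrderDual.ofDual p).1,
      div_anti_right _ (OrderDual.ofDual p).2.2, div_anti_right _ (OrderDual.ofDual p).2.1⟩,
      fun q => OrderDual.toDual ⟨ω / q.1, ?_, ?_⟩, ?_, ?_⟩ ?_)).symm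
  · exact (hdual J hJ (fg_of_le hI h)).ge.trans (div_anti_right _ q.2.2)
  · exact (div_anti_right _ q.2.1).trans (hdual I hI0 hI).le
  · intro p
    apply OrderDual.ofDual.injective
    apply Subtype.ext
    exact hdual _ (ne_bot_of_le hJ (OrderDual.ofDual p).2.1) (fg_of_le hI (OrderDual.ofDual p).2.2)
  · intro q
    apply Subtype.ext
    exact hdual _ (ne_bot_of_le (div_ne_bot hω0 hI) q.2.1) (fg_of_le (div_fg hωfg hJ) q.2.2)
  · intro p q
    constructor
    · intro hpq
      have := div_anti_right ω hpq
      change ω / (ω / (OrderDual.ofDual q).1) ≤ ω / (ω / (OrderDual.ofDual p).1) at this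
      rwa [hdual _ (ne_bot_of_le hJ (OrderDual.ofDual p).2.1)
        (fg_of_le hI (OrderDual.ofDual p).2.2),
        hdual _ (ne_bot_of_le hJ (OrderDual.ofDual q).2.1)
        (fg_of_le hI (OrderDual.ofDual q).2.2)] at this
    · intro hpq
      exact div_anti_right ω hpq

variable [Ring.KrullDimLE 1 R]

/-- A common denominator puts A inside a cyclic module Ry, and B contains some nonzero R(ry). The
quotient is thus a subquotient of R/rR, which has finite length in dimension at most one. -/
theorem qlen_ne_top {A B : Submodule R K} (h : B ≤ A) (hA : A.FG) (hB : B ≠ ⊥) :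
    qlen A B ≠ ⊤ := by
  obtain ⟨y, hy0, hy⟩ := exists_le_span_singleton hA
  obtain ⟨b, hb, hb0⟩ := Submodule.exists_mem_ne_zero_of_ne_bot hB
  obtain ⟨r, rfl⟩ := Submodule.mem_span_singleton.1 (hy (h hb))
  have hr : r ≠ 0 := by rintro rfl; simp at hb0
  have h1 : Submodule.span R {r • y} ≤ B := (Submodule.span_singleton_le_iff_mem _ _).2 hb
  have h2 : qlen (Submodule.span R {y}) (Submodule.span R {r • y}) ≠ ⊤ := by
    have hinj : Function.Injective (LinearMap.toSpanSingleton R K y) := by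
      intro a b hab
      simp only [LinearMap.toSpanSingleton_apply, Algebra.smul_def] at hab
      exact IsFractionRing.injective R K (mul_right_cancel₀ hy0 hab)
    have e1 : Submodule.span R {y} = (⊤ : Submodule R R).map (LinearMap.toSpanSingleton R K y) := by
      rw [Submodule.map_top, LinearMap.range_toSpanSingleton]
    have e2 : Submodule.span R {r • y} =
        Submodule.map (LinearMap.toSpanSingleton R K y) (Ideal.span {r} : Ideal R) := by
      rw [← Ideal.submodule_span_eq, Submodule.map_span, Set.image_singleton,
        LinearMap.toSpanSingleton_apply]
    rw [e1, e2, qlen_map _ hinj le_top]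
    have h3 := isFiniteLength_quotient_span_singleton R (mem_nonZeroDivisors_of_ne_zero hr)
    rw [← Module.length_ne_top_iff, Module.length_quotient] at h3
    have : (qlen ⊤ (Ideal.span {r} : Submodule R R) : WithBot ℕ∞) =
        Order.coheight (Ideal.span {r} : Submodule R R) := by
      rw [coe_qlen le_top, Order.coheight_eq_krullDim_Ici, Set.Icc_top]
    rw [WithBot.coe_injective this]
    exact h3
  rw [qlen_add hy (h1.trans h), qlen_add h h1] at h2
  intro h3
  simp [h3] at h2

theorem coe_len {A B : Submodule R K} (h : B ≤ A) (hA : A.FG) (hB : B ≠ ⊥) :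
    (len A B : ℕ∞) = qlen A B := by
  rw [len_eq_toNat_qlen, ENat.natCast_toNat (qlen_ne_top h hA hB)]

theorem len_add {A B C : Submodule R K} (hBA : B ≤ A) (hCB : C ≤ B) (hA : A.FG) (hC : C ≠ ⊥) :
    len A C = len A B + len B C := by
  have : (len A C : ℕ∞) = len A B + len B C := by
    rw [coe_len (hCB.trans hBA) hA hC, coe_len hBA hA (ne_bot_of_le hC hCB),
      coe_len hCB (fg_of_le hA hBA) hC, qlen_add hBA hCB]
  exact_mod_cast this

/-- The finiteness hypotheses matter: `len` also takes the default value 0 on quotients of infinite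
length. -/
theorem eq_of_len_eq_zero {A B : Submodule R K} (h : B ≤ A) (hA : A.FG) (hB : B ≠ ⊥)
    (h0 : len A B = 0) : A = B := by
  refine le_antisymm (qlen_eq_zero_iff.1 ?_) h
  rw [← coe_len h hA hB, h0]; rfl

theorem len_eq_one_iff {A B : Submodule R K} (h : B ≤ A) (hA : A.FG) (hB : B ≠ ⊥) :
    len A B = 1 ↔ B ⋖ A := by
  rw [← qlen_eq_one_iff h, ← coe_len h hA hB]
  exact_mod_cast Iff.rfl

/-- The length of `A / xA` does not depend on the fractional ideal `A`. -/
theorem len_span_singleton_mul_self {x : R} (hx : x ≠ 0) {A : Submodule R K} (hA : A.FG)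
    (hA0 : A ≠ ⊥) :
    len A (Submodule.span R {algebraMap R K x} * A) =
      len 1 (Submodule.span R {algebraMap R K x}) := by
  have hx0 : algebraMap R K x ≠ 0 := by simpa using hx
  set X := Submodule.span R {algebraMap R K x}
  have hle : ∀ A : Submodule R K, X * A ≤ A := by
    intro A
    rw [Submodule.mul_le]
    intro y hy z hz
    obtain ⟨r, rfl⟩ := Submodule.mem_span_singleton.1 hy
    rw [Algebra.smul_def, ← map_mul, ← Algebra.smul_def]
    exact A.smul_mem _ hz
  have hne : ∀ A : Submodule R K, A ≠ ⊥ → X * A ≠ ⊥ := by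
    intro A hA
    obtain ⟨a, ha, ha0⟩ := Submodule.exists_mem_ne_zero_of_ne_bot hA
    exact (Submodule.ne_bot_iff _).2 ⟨_, Submodule.mem_span_singleton_mul.2 ⟨a, ha, rfl⟩,
      mul_ne_zero hx0 ha0⟩
  -- Computing ℓ(C/xA) through A and through xC, the terms ℓ(C/A) and ℓ(xC/xA) cancel. Two arbitrary
  -- fractional ideals are then compared through their sum.
  have key : ∀ A C : Submodule R K, A ≤ C → C.FG → A ≠ ⊥ → len A (X * A) = len C (X * C) := by
    intro A C hAC hC hA0
    have h1 := len_add hAC (hle A) hC (hne A hA0)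
    have h2 := len_add (hle C) (mul_le_mul_right hAC X : X * A ≤ X * C) hC (hne A hA0)
    have h3 : len (X * C) (X * A) = len C A := len_span_singleton_mul hx0 hAC
    omega
  rw [key A (A ⊔ 1) le_sup_left (hA.sup one_fg) hA0,
    ← key 1 (A ⊔ 1) le_sup_right (hA.sup one_fg) one_ne_bot, mul_one]

end Fractional

/-! ### Values, the conductor and the type sequence -/

section Valuation

open IsDiscreteValuationRing

variable {R : Type*} [CommRing R] {K : Type*} [Field K] [Algebra R K]

theorem one_le_Rbar : (1 : Submodule R K) ≤ Rbar R K :=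
  Submodule.one_le.2 (one_mem (integralClosure R K))

theorem condIdeal_le_one : condIdeal R K ≤ 1 :=
  (div_anti_right 1 one_le_Rbar).trans (div_one_eq 1).le

theorem mem_Rbar {y : K} : y ∈ Rbar R K ↔ ∃ u : integralClosure R K, (u : K) = y :=
  ⟨fun h => ⟨⟨y, h⟩, rfl⟩, by rintro ⟨u, rfl⟩; exact u.2⟩

theorem Rbar_fg [Module.Finite R (integralClosure R K)] : (Rbar R K).FG :=
  Module.Finite.iff_fg.1 ‹_›

variable [IsDiscreteValuationRing (integralClosure R K)]

variable (R K) in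
/-- The elements of valuation at least `k`. -/
def valFil (k : ℕ) : Submodule R K where
  carrier := {y | ∃ u : integralClosure R K, (u : K) = y ∧
    (k : ℕ∞) ≤ addVal (integralClosure R K) u}
  add_mem' := by
    rintro _ _ ⟨u, rfl, hu⟩ ⟨w, rfl, hw⟩
    exact ⟨u + w, rfl, (le_min hu hw).trans addVal_add⟩
  zero_mem' := ⟨0, rfl, by simp⟩
  smul_mem' := by
    rintro r _ ⟨u, rfl, hu⟩
    refine ⟨r • u, rfl, ?_⟩
    rw [Algebra.smul_def, addVal_mul]
    exact hu.trans le_add_self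

theorem coe_mem_valFil {k : ℕ} {u : integralClosure R K} :
    (u : K) ∈ valFil R K k ↔ (k : ℕ∞) ≤ addVal (integralClosure R K) u := by
  constructor
  · rintro ⟨w, hw, h⟩
    rwa [← Subtype.ext hw]
  · exact fun h => ⟨u, rfl, h⟩

theorem valFil_le_Rbar (k : ℕ) : valFil R K k ≤ Rbar R K := by
  rintro _ ⟨u, rfl, -⟩
  exact u.2

theorem valFil_zero : valFil R K 0 = Rbar R K := by
  refine le_antisymm (valFil_le_Rbar 0) fun y hy => ?_
  obtain ⟨u, rfl⟩ := mem_Rbar.1 hy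
  exact coe_mem_valFil.2 (by simp)

theorem valFil_antitone : Antitone (valFil R K) := by
  rintro a b hab _ ⟨u, rfl, hu⟩
  exact ⟨u, rfl, le_trans (by exact_mod_cast hab) hu⟩

theorem values_mono {A B : Submodule R K} (h : A ≤ B) : values A ⊆ values B := by
  rintro k ⟨u, hu, hk⟩
  exact ⟨u, h hu, hk⟩

theorem zero_mem_values_one : 0 ∈ values (1 : Submodule R K) :=
  ⟨1, Submodule.one_le.1 le_rfl, by simp⟩

theorem exists_addVal_eq {u : integralClosure R K} (hu : u ≠ 0) :
    ∃ k : ℕ, addVal (integralClosure R K) u = k := by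
  obtain ⟨k, hk⟩ := ENat.ne_top_iff_exists.1 (mt addVal_eq_top_iff.1 hu)
  exact ⟨k, hk.symm⟩

theorem inf_valFil_ne_bot {A : Submodule R K} {c : ℕ} (hc : valFil R K c ≤ A) (k : ℕ) :
    A ⊓ valFil R K k ≠ ⊥ := by
  obtain ⟨p, hp⟩ := exists_irreducible (integralClosure R K)
  refine (Submodule.ne_bot_iff _).2 ⟨((p ^ (c + k) : integralClosure R K) : K),
    ⟨hc (coe_mem_valFil.2 ?_), coe_mem_valFil.2 ?_⟩, ?_⟩
  · rw [hp.addVal_pow]; exact_mod_cast Nat.le_add_right c k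
  · rw [hp.addVal_pow]; exact_mod_cast Nat.le_add_left k c
  · rw [Ne, ZeroMemClass.coe_eq_zero]
    exact pow_ne_zero _ hp.ne_zero

theorem mem_values_of_valFil_le {A : Submodule R K} {c k : ℕ} (h : valFil R K c ≤ A)
    (hk : c ≤ k) : k ∈ values A := by
  obtain ⟨p, hp⟩ := exists_irreducible (integralClosure R K)
  refine ⟨p ^ k, h (coe_mem_valFil.2 ?_), hp.addVal_pow k⟩
  rw [hp.addVal_pow]
  exact_mod_cast hk

theorem frac_idealR (i : ℕ) : frac K (idealR R K i) = 1 ⊓ valFil R K (sElem R K i) := by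
  ext y
  rw [frac, IsLocalization.mem_coeSubmodule, Submodule.mem_inf, Submodule.mem_one]
  constructor
  · rintro ⟨r, hr, rfl⟩
    exact ⟨⟨r, rfl⟩, coe_mem_valFil (u := algebraMap R (integralClosure R K) r).2 hr⟩
  · rintro ⟨⟨r, rfl⟩, h⟩
    exact ⟨r, coe_mem_valFil (u := algebraMap R (integralClosure R K) r).1 h, rfl⟩

theorem sElem_zero : sElem R K 0 = 0 := Nat.nth_zero_of_zero zero_mem_values_one

theorem frac_idealR_zero : frac K (idealR R K 0) = 1 := by
  rw [frac_idealR, sElem_zero, valFil_zero, inf_eq_left.2 one_le_Rbar]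

section

variable [IsDomain R] [IsFractionRing R K] [Module.Finite R (integralClosure R K)]

variable (R K) in
/-- The conductor is the set of elements of valuation at least some `c`, and its dual is the
integral closure. -/
theorem exists_condIdeal_eq :
    ∃ c : ℕ, condIdeal R K = valFil R K c ∧ dual (condIdeal R K) = Rbar R K := by
  classical
  have hle : condIdeal R K ≤ Rbar R K := condIdeal_le_one.trans one_le_Rbar
  obtain ⟨y, hy, hy0⟩ := Submodule.exists_mem_ne_zero_of_ne_bot
    (div_ne_bot (A := 1) one_ne_bot (Rbar_fg (R := R) (K := K)))
  have hex : ∃ c, c ∈ values (condIdeal R K) := by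
    obtain ⟨y, rfl⟩ := mem_Rbar.1 (hle hy)
    obtain ⟨k, hk⟩ := exists_addVal_eq (u := y) (by rintro rfl; exact hy0 rfl)
    exact ⟨k, y, hy, hk⟩
  obtain ⟨y, hyγ, hyc⟩ := Nat.find_spec hex
  have hmin : ∀ u : integralClosure R K, (u : K) ∈ condIdeal R K →
      (Nat.find hex : ℕ∞) ≤ addVal (integralClosure R K) u := by
    intro u hu
    rcases eq_or_ne u 0 with rfl | hu0
    · simp
    · obtain ⟨k, hk⟩ := exists_addVal_eq hu0
      rw [hk]
      exact_mod_cast Nat.find_min' hex ⟨u, hu, hk⟩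
  have hy0 : (y : K) ≠ 0 := by
    intro h
    rw [show y = 0 from Subtype.ext h, addVal_zero] at hyc
    exact ENat.top_ne_natCast _ hyc
  refine ⟨Nat.find hex, le_antisymm ?_ ?_, le_antisymm ?_ (le_div_div _ _)⟩
  · intro w hw
    obtain ⟨w, rfl⟩ := mem_Rbar.1 (hle hw)
    exact coe_mem_valFil.2 (hmin w hw)
  · rintro _ ⟨w, rfl, hw⟩
    obtain ⟨u, rfl⟩ := addVal_le_iff_dvd.1 (hyc.le.trans hw)
    refine Submodule.mem_div_iff_forall_mul_mem.2 fun z hz => ?_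
    rw [Subalgebra.coe_mul, mul_assoc]
    exact Submodule.mem_div_iff_forall_mul_mem.1 hyγ _ ((integralClosure R K).mul_mem u.2 hz)
  · intro z hz
    -- If z maps the conductor into R, its image is stable under V, so lies in the conductor. Hence
    -- zy has at least the value of y, the least one there, and dividing by y puts z in V.
    have hzy : z * y ∈ condIdeal R K := by
      refine Submodule.mem_div_iff_forall_mul_mem.2 fun w hw => ?_
      rw [mul_assoc]
      refine Submodule.mem_div_iff_forall_mul_mem.1 hz _ ?_
      refine Submodule.mem_div_iff_forall_mul_mem.2 fun w' hw' => ?_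
      rw [mul_assoc]
      exact Submodule.mem_div_iff_forall_mul_mem.1 hyγ _ ((integralClosure R K).mul_mem hw hw')
    obtain ⟨w, hw⟩ := mem_Rbar.1 (hle hzy)
    obtain ⟨u, rfl⟩ := addVal_le_iff_dvd.1 (hyc.le.trans (hmin w (hw ▸ hzy)))
    rw [Subalgebra.coe_mul, mul_comm] at hw
    rw [← mul_right_cancel₀ hy0 hw]
    exact u.2

variable (R K) in
theorem infinite_values_one :
    (Set.ofPred fun a => a ∈ values (1 : Submodule R K)).Infinite := by
  obtain ⟨c, hc, -⟩ := exists_condIdeal_eq R K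
  exact (Set.Ici_infinite c).mono fun k hk => mem_values_of_valFil_le (hc ▸ condIdeal_le_one) hk

theorem sElem_strictMono : StrictMono (sElem R K) := Nat.nth_strictMono (infinite_values_one R K)

theorem dual_frac_idealR_mono : Monotone fun i => dual (frac K (idealR R K i)) := by
  intro i j hij
  refine div_anti_right 1 ?_
  rw [frac_idealR, frac_idealR]
  exact inf_le_inf_left _ (valFil_antitone (sElem_strictMono.monotone hij))

theorem sum_typeSeq_eq_len [IsNoetherianRing R] [Ring.KrullDimLE 1 R] (m : ℕ) :
    ∑ i ∈ Finset.Icc 1 m, typeSeq R K i = len (dual (frac K (idealR R K m))) 1 := by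
  obtain ⟨c, hc, -⟩ := exists_condIdeal_eq R K
  have h0 : dual (frac K (idealR R K 0)) = 1 := by rw [frac_idealR_zero, dual, div_one_eq]
  induction m with
  | zero => rw [h0, len_self]; rfl
  | succ m ih =>
    rw [Finset.sum_Icc_succ_top (by omega), ih, typeSeq, Nat.add_sub_cancel, add_comm]
    refine (len_add (dual_frac_idealR_mono m.le_succ) ?_ (div_fg one_fg ?_) one_ne_bot).symm
    · exact h0.ge.trans (dual_frac_idealR_mono (Nat.zero_le m))
    · rw [frac_idealR]
      exact inf_valFil_ne_bot (c := c) (hc ▸ condIdeal_le_one) _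

end

variable [IsLocalRing R] [IsDomain R] [IsFractionRing R K]

theorem one_le_addVal_algebraMap_iff {r : R} :
    1 ≤ addVal (integralClosure R K) (algebraMap R (integralClosure R K) r) ↔
      r ∈ maximalIdeal R := by
  have : FaithfulSMul R K := (faithfulSMul_iff_algebraMap_injective R K).2
    (IsFractionRing.injective R K)
  rw [mem_maximalIdeal, mem_nonunits_iff, Order.one_le_iff_pos, pos_iff_ne_zero, Ne,
    addVal_eq_zero_iff, isUnit_map_iff]

theorem algebraMap_mem_valFil_one_iff {r : R} :
    algebraMap R K r ∈ valFil R K 1 ↔ r ∈ maximalIdeal R := by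
  rw [← one_le_addVal_algebraMap_iff (K := K)]
  exact coe_mem_valFil (u := algebraMap R (integralClosure R K) r)

theorem frac_maximalIdeal : frac K (maximalIdeal R) = 1 ⊓ valFil R K 1 := by
  ext y
  rw [frac, IsLocalization.mem_coeSubmodule, Submodule.mem_inf, Submodule.mem_one]
  constructor
  · rintro ⟨r, hr, rfl⟩
    exact ⟨⟨r, rfl⟩, algebraMap_mem_valFil_one_iff.2 hr⟩
  · rintro ⟨⟨r, rfl⟩, h⟩
    exact ⟨r, algebraMap_mem_valFil_one_iff.1 h, rfl⟩

/-- Residual rationality: passing from `v ≥ k` to `v ≥ k + 1` drops the length by one exactly when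
`k` is a value. -/
theorem qlen_inf_valFil_succ (hrat : ResiduallyRational R K) (I : Submodule R K) (k : ℕ)
    [Decidable (k ∈ values I)] :
    qlen (I ⊓ valFil R K k) (I ⊓ valFil R K (k + 1)) = if k ∈ values I then 1 else 0 := by
  have hle : I ⊓ valFil R K (k + 1) ≤ I ⊓ valFil R K k :=
    inf_le_inf_left _ (valFil_antitone k.le_succ)
  split_ifs with hk
  · obtain ⟨y, hyI, hyk⟩ := hk
    have hyF : (y : K) ∈ valFil R K k := coe_mem_valFil.2 hyk.ge
    have hsup : I ⊓ valFil R K k = (I ⊓ valFil R K (k + 1)) ⊔ Submodule.span R {(y : K)} := by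
      refine le_antisymm ?_ (sup_le hle ((Submodule.span_singleton_le_iff_mem _ _).2 ⟨hyI, hyF⟩))
      rintro w ⟨hwI, hwF⟩
      obtain ⟨w, rfl⟩ := mem_Rbar.1 (valFil_le_Rbar _ hwF)
      obtain ⟨u, rfl⟩ := addVal_le_iff_dvd.1 (hyk.le.trans (coe_mem_valFil.1 hwF))
      -- Residual rationality gives r ∈ R with the residue of u, so subtracting r y raises the value
      -- above k.
      obtain ⟨r, hr⟩ := hrat (residue _ u)
      have hur : 1 ≤ addVal (integralClosure R K) (u - algebraMap R _ r) := by
        rw [Order.one_le_iff_pos, pos_iff_ne_zero, Ne, addVal_eq_zero_iff, ← mem_nonunits_iff,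
          ← mem_maximalIdeal, ← residue_eq_zero_iff, map_sub, sub_eq_zero]
        exact hr.symm
      have e : ((y * u : integralClosure R K) : K) =
          ((y * (u - algebraMap R _ r) : integralClosure R K) : K) + r • (y : K) := by
        rw [← Subalgebra.coe_smul, ← Subalgebra.coe_add, Algebra.smul_def]
        congr 1; ring
      have hry : r • (y : K) ∈ Submodule.span R {(y : K)} :=
        Submodule.smul_mem _ _ (Submodule.mem_span_singleton_self _)
      have hI : ((y * (u - algebraMap R _ r) : integralClosure R K) : K) ∈ I := by
        rw [← sub_eq_iff_eq_add.2 e]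
        exact I.sub_mem hwI (I.smul_mem _ hyI)
      rw [e]
      refine Submodule.add_mem_sup ⟨hI, coe_mem_valFil.2 ?_⟩ hry
      rw [addVal_mul, hyk]
      push_cast
      gcongr
    refine le_antisymm ?_ ?_
    · rw [hsup]
      refine qlen_sup_span_singleton_le_one fun r hr => ⟨I.smul_mem _ hyI, ?_⟩
      rw [← Subalgebra.coe_smul]
      refine coe_mem_valFil.2 ?_
      rw [Algebra.smul_def, addVal_mul, hyk, add_comm]
      push_cast
      gcongr
      exact one_le_addVal_algebraMap_iff.2 hr
    · rw [Order.one_le_iff_pos, pos_iff_ne_zero, Ne, qlen_eq_zero_iff]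
      intro h
      have := coe_mem_valFil.1 (h ⟨hyI, hyF⟩).2
      rw [hyk] at this
      exact absurd this (by exact_mod_cast k.lt_succ_self.not_ge)
  · rw [qlen_eq_zero_iff]
    rintro w ⟨hwI, hwF⟩
    obtain ⟨w, rfl⟩ := mem_Rbar.1 (valFil_le_Rbar _ hwF)
    refine ⟨hwI, coe_mem_valFil.2 ?_⟩
    have h1 := coe_mem_valFil.1 hwF
    push_cast
    refine Order.add_one_le_of_lt (lt_of_le_of_ne h1 fun h2 => hk ⟨w, hwI, h2.symm⟩)

open Classical in
theorem qlen_inf_valFil (hrat : ResiduallyRational R K) {I : Submodule R K} (hI : I ≤ Rbar R K)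
    (k : ℕ) : qlen I (I ⊓ valFil R K k) = Nat.count (· ∈ values I) k := by
  induction k with
  | zero => rw [valFil_zero, inf_eq_left.2 hI, qlen_eq_zero_iff.2 le_rfl, Nat.count_zero]; rfl
  | succ k ih =>
    rw [qlen_add (B := I ⊓ valFil R K k) inf_le_left
      (inf_le_inf_left _ (valFil_antitone k.le_succ)), ih, qlen_inf_valFil_succ hrat,
      Nat.count_succ]
    push_cast
    rfl

open Classical in
theorem len_inf_valFil (hrat : ResiduallyRational R K) {I : Submodule R K} (hI : I ≤ Rbar R K)
    (k : ℕ) : len I (I ⊓ valFil R K k) = Nat.count (· ∈ values I) k := by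
  rw [len_eq_toNat_qlen, qlen_inf_valFil hrat hI]; rfl

open Classical in
theorem numTS_eq_count (hrat : ResiduallyRational R K) {c : ℕ}
    (hc : condIdeal R K = valFil R K c) :
    numTS R K = Nat.count (· ∈ values (1 : Submodule R K)) c := by
  rw [← len_inf_valFil hrat one_le_Rbar, ← hc, inf_eq_right.2 condIdeal_le_one, numTS]

/-- By residual rationality n counts the values of R below the exponent c of the conductor, and c is
itself a value. So R_n is the conductor, where the type sequence ends. -/
theorem sElem_numTS (hrat : ResiduallyRational R K) {c : ℕ}
    (hc : condIdeal R K = valFil R K c) : sElem R K (numTS R K) = c := by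
  classical
  rw [numTS_eq_count hrat hc, sElem]
  exact Nat.nth_count (mem_values_of_valFil_le (hc ▸ condIdeal_le_one) le_rfl)

variable [Module.Finite R (integralClosure R K)]

theorem frac_idealR_one : frac K (idealR R K 1) = frac K (maximalIdeal R) := by
  classical
  rw [frac_idealR, frac_maximalIdeal]
  have h01 : sElem R K 0 < sElem R K 1 := sElem_strictMono one_pos
  refine le_antisymm (inf_le_inf_left _ (valFil_antitone (by omega))) ?_
  rintro y ⟨hy1, hy⟩
  refine ⟨hy1, ?_⟩
  obtain ⟨u, rfl⟩ := mem_Rbar.1 (one_le_Rbar hy1)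
  refine coe_mem_valFil.2 ?_
  rcases eq_or_ne u 0 with rfl | hu0
  · simp
  obtain ⟨k, hk⟩ := exists_addVal_eq hu0
  have hk1 := coe_mem_valFil.1 hy
  rw [hk] at hk1 ⊢
  have hk1 : 1 ≤ k := by exact_mod_cast hk1
  have hkS : k ∈ values (1 : Submodule R K) := ⟨u, hy1, hk⟩
  have hcount : 1 ≤ Nat.count (· ∈ values (1 : Submodule R K)) k :=
    Nat.one_le_iff_ne_zero.2 (Nat.count_ne_iff_exists.2 ⟨0, hk1, zero_mem_values_one⟩)
  have := Nat.nth_monotone (infinite_values_one R K) hcount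
  rw [Nat.nth_count hkS] at this
  exact_mod_cast this

theorem typeSeq_one : typeSeq R K 1 = len (dual (frac K (maximalIdeal R))) 1 := by
  rw [typeSeq, frac_idealR_one, Nat.sub_self, frac_idealR_zero, dual, dual, div_one_eq]

-- The index i corresponds to the value s_(i-1). The inverse sends k to one more than the number of
-- values of R below k, because indices in Γ start at 1 while s starts at 0.
open Classical in
theorem card_Gam (hrat : ResiduallyRational R K) {c : ℕ}
    (hc : condIdeal R K = valFil R K c) (I : Ideal R) (hI : dual (blowup K I) ≤ 1) :
    (Gam K I).card = Nat.count (· ∈ values (dual (blowup K I))) c := by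
  rw [Nat.count_eq_card_filter_range]
  have hsub := values_mono hI
  refine Finset.card_nbij' (fun i => sElem R K (i - 1))
    (fun k => Nat.count (· ∈ values (1 : Submodule R K)) k + 1) ?_ ?_ ?_ ?_
  · intro i hi
    simp only [Gam, Finset.coe_filter, Finset.mem_Icc, Finset.mem_range, Set.mem_ofPred_eq] at hi ⊢
    refine ⟨?_, hi.2⟩
    rw [← sElem_numTS hrat hc]
    exact sElem_strictMono (by omega)
  · intro k hk
    simp only [Gam, Finset.coe_filter, Finset.mem_Icc, Finset.mem_range, Set.mem_ofPred_eq] at hk ⊢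
    refine ⟨⟨by omega, ?_⟩, ?_⟩
    · rw [numTS_eq_count hrat hc]
      exact Nat.count_strict_mono (hsub hk.2) hk.1
    · rw [Nat.add_sub_cancel, sElem, Nat.nth_count (hsub hk.2)]
      exact hk.2
  · intro i hi
    simp only [Gam, Finset.coe_filter, Finset.mem_Icc, Set.mem_ofPred_eq] at hi
    simp only [sElem]
    rw [Nat.count_nth_of_infinite (infinite_values_one R K)]
    omega
  · intro k hk
    simp only [Finset.coe_filter, Finset.mem_range, Set.mem_ofPred_eq] at hk
    simp only [Nat.add_sub_cancel, sElem]
    exact Nat.nth_count (hsub hk.2)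

variable [IsNoetherianRing R] [Ring.KrullDimLE 1 R]

/-- The sum telescopes to ℓ((R : R_n)/R); R_n is the conductor, and its dual is V. -/
theorem sum_typeSeq (hrat : ResiduallyRational R K) :
    ∑ i ∈ Finset.Icc 1 (numTS R K), typeSeq R K i = delta R K := by
  obtain ⟨c, hc, hd⟩ := exists_condIdeal_eq R K
  rw [sum_typeSeq_eq_len, frac_idealR, sElem_numTS hrat hc, ← hc, inf_eq_right.2 condIdeal_le_one,
    hd, delta]

/-- The indices outside `Γ` count the length of `R / (R : Λ)`. -/
theorem card_Gam_add_len (hrat : ResiduallyRational R K) (I : Ideal R)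
    (hI : 1 ≤ blowup K I) (hI' : blowup K I ≤ Rbar R K) :
    (Gam K I).card + len 1 (dual (blowup K I)) = numTS R K := by
  obtain ⟨c, hc, -⟩ := exists_condIdeal_eq R K
  have hD1 : dual (blowup K I) ≤ 1 := (div_anti_right 1 hI).trans (div_one_eq 1).le
  have hD : condIdeal R K ≤ dual (blowup K I) := div_anti_right 1 hI'
  rw [card_Gam hrat hc I hD1, ← len_inf_valFil hrat (hD1.trans one_le_Rbar), ← hc,
    inf_eq_right.2 hD, numTS, add_comm]
  refine (len_add hD1 hD one_fg ?_).symm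
  exact div_ne_bot one_ne_bot Rbar_fg

end Valuation

theorem pow_eq_of_pow_succ_eq {M : Type*} [Monoid M] {a : M} {k : ℕ} (hk : a ^ (k + 1) = a ^ k)
    {n : ℕ} (hn : k ≤ n) : a ^ n = a ^ k := by
  induction n, hn using Nat.le_induction with
  | base => rfl
  | succ n _ ih => rw [pow_succ, ih, ← pow_succ, hk]

/-! ### Hilbert function, multiplicity and embedding dimension -/

section Hilbert

variable {R : Type*} [CommRing R] {K : Type*} [Field K] [Algebra R K]

theorem frac_pow (I : Ideal R) (n : ℕ) : frac K (I ^ n) = frac K I ^ n := by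
  induction n with
  | zero => rw [pow_zero, pow_zero, Ideal.one_eq_top, frac, IsLocalization.coeSubmodule_top]
  | succ n ih => rw [pow_succ, pow_succ, ← ih]; exact IsLocalization.coeSubmodule_mul K _ _

theorem frac_fg [IsNoetherianRing R] (I : Ideal R) : (frac K I).FG :=
  Submodule.FG.map _ (IsNoetherian.noetherian I)

theorem frac_le_one (I : Ideal R) : frac K I ≤ 1 := by
  rw [← IsLocalization.coeSubmodule_top K]
  exact IsLocalization.coeSubmodule_mono K le_top

theorem pow_fg {A : Submodule R K} (hA : A.FG) (n : ℕ) : (A ^ n).FG := hA.pow n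

theorem pow_ne_bot {A : Submodule R K} (hA : A ≠ ⊥) (n : ℕ) : A ^ n ≠ ⊥ := by
  obtain ⟨a, ha, ha0⟩ := Submodule.exists_mem_ne_zero_of_ne_bot hA
  exact (Submodule.ne_bot_iff _).2 ⟨a ^ n, Submodule.pow_mem_pow A ha n, pow_ne_zero n ha0⟩

theorem span_singleton_mul_ne_bot {x : K} (hx : x ≠ 0) {A : Submodule R K} (hA : A ≠ ⊥) :
    Submodule.span R {x} * A ≠ ⊥ := by
  obtain ⟨a, ha, ha0⟩ := Submodule.exists_mem_ne_zero_of_ne_bot hA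
  exact (Submodule.ne_bot_iff _).2 ⟨_, Submodule.mem_span_singleton_mul.2 ⟨a, ha, rfl⟩,
    mul_ne_zero hx ha0⟩

theorem hilbertFun_eq_len [IsDomain R] [IsFractionRing R K] (I : Ideal R) (n : ℕ) :
    hilbertFun I n = len (frac K I ^ n) (frac K I ^ (n + 1)) := by
  rw [← frac_pow, ← frac_pow]
  exact (len_map (Algebra.linearMap R K) (IsFractionRing.injective R K)
    (Ideal.pow_le_pow_right n.le_succ)).symm

/-- If the Hilbert function is eventually constant, its eventual value is the multiplicity. -/
theorem mult_eq_of_hilbertFun_eq (I : Ideal R) {e k : ℕ} (h : ∀ n ≥ k, hilbertFun I n = e) :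
    mult I = e := by
  have hcoeff : ∀ n, PowerSeries.coeff (n + 1)
      ((1 - (PowerSeries.X : PowerSeries ℤ)) * hilbertSeries I) =
      (hilbertFun I (n + 1) : ℤ) - hilbertFun I n := by
    intro n
    rw [sub_mul, one_mul, map_sub, PowerSeries.coeff_succ_X_mul]
    simp [hilbertSeries]
  have hcoeff0 : PowerSeries.coeff 0
      ((1 - (PowerSeries.X : PowerSeries ℤ)) * hilbertSeries I) = (hilbertFun I 0 : ℤ) := by
    rw [sub_mul, one_mul, map_sub, PowerSeries.coeff_zero_X_mul]
    simp [hilbertSeries]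
  have hex : ∃ p : Polynomial ℤ,
      (p : PowerSeries ℤ) = (1 - (PowerSeries.X : PowerSeries ℤ)) * hilbertSeries I := by
    refine ⟨PowerSeries.trunc (k + 1) ((1 - (PowerSeries.X : PowerSeries ℤ)) * hilbertSeries I), ?_⟩
    ext n
    rw [Polynomial.coeff_coe, PowerSeries.coeff_trunc]
    split_ifs with hn
    · rfl
    · obtain ⟨m, rfl⟩ : ∃ m, n = m + 1 := ⟨n - 1, by omega⟩
      rw [hcoeff, h (m + 1) (by omega), h m (by omega), sub_self]
  have hspec : (hPoly I : PowerSeries ℤ) =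
      (1 - (PowerSeries.X : PowerSeries ℤ)) * hilbertSeries I := by
    rw [hPoly, dif_pos hex]; exact hex.choose_spec
  have hsum : ∀ n, ∑ i ∈ Finset.range (n + 1), (hPoly I).coeff i = hilbertFun I n := by
    intro n
    induction n with
    | zero => rw [zero_add, Finset.sum_range_one, ← Polynomial.coeff_coe, hspec, hcoeff0]
    | succ n ih =>
      rw [Finset.sum_range_succ, ih, ← Polynomial.coeff_coe, hspec, hcoeff]; ring
  rw [mult, Polynomial.eval_eq_sum_range' (n := max k (hPoly I).natDegree + 1) (by omega)]
  simp only [one_pow, mul_one]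
  rw [hsum, h _ (le_max_left _ _)]

theorem embDim_eq_hilbertFun [IsNoetherianRing R] [IsLocalRing R] :
    embDim R = hilbertFun (maximalIdeal R) 1 := by
  have h1 : Module.length R (CotangentSpace R) = embDim R := by
    rw [Module.length_eq_of_surjective (R := ResidueField R) residue_surjective,
      Module.length_eq_finrank, embDim]
  have h2 : Module.length R (CotangentSpace R) =
      qlen (maximalIdeal R) (maximalIdeal R ^ 2) := by
    have : (maximalIdeal R • ⊤ : Submodule R (maximalIdeal R)) =
        (maximalIdeal R ^ 2).submoduleOf (maximalIdeal R) := by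
      refine Submodule.map_injective_of_injective (maximalIdeal R).injective_subtype ?_
      rw [Submodule.map_smul'', Submodule.map_top, Submodule.range_subtype, smul_eq_mul, ← sq]
      simp only [Submodule.submoduleOf, Submodule.map_comap_subtype]
      exact (inf_eq_right.2 (Ideal.pow_le_self two_ne_zero)).symm
    rw [qlen, ← this]
    rfl
  rw [hilbertFun, pow_one, len_eq_toNat_qlen, ← h2, h1]
  rfl

end Hilbert

/-! ### The chain x⁻ⁿ𝔪ⁿ, multiplicity, reduction exponent and blowing-up -/

section Reduction

variable {R : Type*} [CommRing R] [IsLocalRing R] (K : Type*) [Field K] [Algebra R K]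

/-- The fractional ideal `x⁻¹ 𝔪`. -/
def scaledMax (x : R) : Submodule R K :=
  Submodule.span R {(algebraMap R K x)⁻¹} * frac K (maximalIdeal R)

theorem scaledMax_pow_fg [IsNoetherianRing R] (x : R) (n : ℕ) : (scaledMax K x ^ n).FG :=
  pow_fg (Submodule.FG.mul (Submodule.fg_span_singleton _) (frac_fg _)) n

/-- `x` is a nonzero element of `𝔪` of least value, expressed as `x⁻¹ 𝔪 ⊆ R̄`. -/
structure IsMinimalValue (x : R) : Prop where
  mem : x ∈ maximalIdeal R
  ne_zero : algebraMap R K x ≠ 0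
  le : scaledMax K x ≤ Rbar R K

variable {K}

theorem exists_isMinimalValue [IsDomain R] [IsFractionRing R K]
    [IsDiscreteValuationRing (integralClosure R K)] (hm : maximalIdeal R ≠ ⊥) :
    ∃ x : R, IsMinimalValue K x := by
  classical
  have hinj := IsFractionRing.injective R K
  obtain ⟨y, hy, hy0⟩ := Submodule.exists_mem_ne_zero_of_ne_bot hm
  have hval : ∀ y : R, y ≠ 0 → ∃ k : ℕ,
      IsDiscreteValuationRing.addVal (integralClosure R K) (algebraMap R _ y) = k := by
    intro y hy
    refine exists_addVal_eq fun h => hy (hinj ?_)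
    simpa using congrArg (algebraMap (integralClosure R K) K) h
  have hex : ∃ k : ℕ, ∃ y ∈ maximalIdeal R,
      IsDiscreteValuationRing.addVal (integralClosure R K) (algebraMap R _ y) = k := by
    obtain ⟨k, hk⟩ := hval y hy0
    exact ⟨k, y, hy, hk⟩
  obtain ⟨x, hx, hxk⟩ := Nat.find_spec hex
  have hx0 : algebraMap R K x ≠ 0 := by
    intro h
    rw [show algebraMap R (integralClosure R K) x = 0 from Subtype.ext h] at hxk
    simp at hxk
  refine ⟨x, hx, hx0, fun z hz => ?_⟩
  obtain ⟨w', hw', rfl⟩ := Submodule.mem_span_singleton_mul.1 hz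
  obtain ⟨w, hw, rfl⟩ := (IsLocalization.mem_coeSubmodule _ _).1 hw'
  have hdvd : algebraMap R (integralClosure R K) x ∣ algebraMap R _ w := by
    rw [← IsDiscreteValuationRing.addVal_le_iff_dvd, hxk]
    rcases eq_or_ne w 0 with rfl | hw0
    · simp
    · obtain ⟨k, hk⟩ := hval w hw0
      rw [hk]
      exact_mod_cast Nat.find_min' hex ⟨w, hw, hk⟩
  obtain ⟨u, hu⟩ := hdvd
  have hu' : algebraMap R K w = algebraMap R K x * u := congrArg Subtype.val hu
  rw [hu', inv_mul_cancel_left₀ hx0]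
  exact u.2

namespace IsMinimalValue

variable {x : R}

theorem span_mul_scaledMax (hx : IsMinimalValue K x) :
    Submodule.span R {algebraMap R K x} * scaledMax K x = frac K (maximalIdeal R) := by
  rw [scaledMax, ← mul_assoc, mul_comm (Submodule.span R {algebraMap R K x}),
    span_singleton_inv_mul_cancel hx.ne_zero, one_mul]

theorem one_le (hx : IsMinimalValue K x) : 1 ≤ scaledMax K x :=
  Submodule.one_le.2 (Submodule.mem_span_singleton_mul.2
    ⟨algebraMap R K x, (IsLocalization.mem_coeSubmodule _ _).2 ⟨x, hx.mem, rfl⟩,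
      inv_mul_cancel₀ hx.ne_zero⟩)

theorem pow_mono (hx : IsMinimalValue K x) : Monotone fun n => scaledMax K x ^ n :=
  pow_right_mono₀ hx.one_le

theorem one_le_pow (hx : IsMinimalValue K x) (n : ℕ) : 1 ≤ scaledMax K x ^ n :=
  one_le_pow₀ hx.one_le

theorem pow_ne_bot (hx : IsMinimalValue K x) (n : ℕ) : scaledMax K x ^ n ≠ ⊥ :=
  ne_bot_of_le one_ne_bot (hx.one_le_pow n)

theorem pow_le_Rbar (hx : IsMinimalValue K x) (n : ℕ) : scaledMax K x ^ n ≤ Rbar R K := by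
  induction n with
  | zero => rw [pow_zero]; exact one_le_Rbar
  | succ n ih =>
    rw [pow_succ, Submodule.mul_le]
    exact fun a ha b hb => (integralClosure R K).mul_mem (ih ha) (hx.le hb)

theorem span_pow_mul_pow (hx : IsMinimalValue K x) (n : ℕ) :
    Submodule.span R {algebraMap R K x ^ n} * scaledMax K x ^ n =
      frac K (maximalIdeal R) ^ n := by
  rw [← hx.span_mul_scaledMax, mul_pow, Submodule.span_pow, Set.singleton_pow]

/-- The chain ascends inside V, a Noetherian R-module. -/
theorem exists_pow_succ_eq (hx : IsMinimalValue K x) [IsNoetherianRing R]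
    [Module.Finite R (integralClosure R K)] :
    ∃ k, scaledMax K x ^ (k + 1) = scaledMax K x ^ k := by
  have : IsNoetherian R (Rbar R K) :=
    inferInstanceAs (IsNoetherian R (integralClosure R K))
  obtain ⟨k, hk⟩ := monotone_stabilizes_iff_noetherian.2 this
    ⟨fun n => (scaledMax K x ^ n).comap (Rbar R K).subtype,
      fun a b hab => Submodule.comap_mono (hx.pow_mono hab)⟩
  refine ⟨k, le_antisymm (fun y hy => ?_) (hx.pow_mono k.le_succ)⟩
  have h := hk (k + 1) k.le_succ
  have h1 : (⟨y, hx.pow_le_Rbar _ hy⟩ : Rbar R K) ∈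
      (scaledMax K x ^ (k + 1)).comap (Rbar R K).subtype := hy
  exact (SetLike.ext_iff.1 h _).2 h1

/-- The blowing-up is the stable value of the chain `x⁻ⁿ 𝔪ⁿ`. -/
theorem blowup_eq (hx : IsMinimalValue K x) {k : ℕ}
    (hk : scaledMax K x ^ (k + 1) = scaledMax K x ^ k) :
    blowup K (maximalIdeal R) = scaledMax K x ^ k := by
  have hdiv : ∀ n, frac K (maximalIdeal R) ^ n / frac K (maximalIdeal R) ^ n =
      scaledMax K x ^ n / scaledMax K x ^ n := by
    intro n
    rw [← hx.span_pow_mul_pow]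
    refine eq_of_forall_le_iff fun D => ?_
    rw [Submodule.le_div_iff_mul_le, Submodule.le_div_iff_mul_le, mul_left_comm,
      span_singleton_mul_le_iff (pow_ne_zero n hx.ne_zero)]
  rw [blowup]
  simp only [hdiv]
  refine le_antisymm (iSup_le fun n => ?_) (le_iSup_of_le k ?_)
  · refine (div_anti_right _ (hx.one_le_pow n)).trans ((div_one_eq _).le.trans ?_)
    exact (hx.pow_mono (le_max_left n k)).trans (pow_eq_of_pow_succ_eq hk (le_max_right n k)).le
  · rw [Submodule.le_div_iff_mul_le, ← pow_add]
    exact (pow_eq_of_pow_succ_eq hk (Nat.le_add_left k k)).le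

section Noetherian

variable [IsNoetherianRing R] [IsDomain R] [IsFractionRing R K] [Ring.KrullDimLE 1 R]

/-- Refine 𝔪ⁿ ⊇ x𝔪ⁿ by 𝔪^(n+1): the total length is ℓ(R/xR), and multiplication by x^(n+1) carries
N^(n+1)/N^n onto 𝔪^(n+1)/x𝔪ⁿ. -/
theorem hilbertFun_add_len (hx : IsMinimalValue K x) (n : ℕ) :
    hilbertFun (maximalIdeal R) n + len (scaledMax K x ^ (n + 1)) (scaledMax K x ^ n) =
      len 1 (Submodule.span R {algebraMap R K x}) := by
  have hx0 : x ≠ 0 := by rintro rfl; exact hx.ne_zero (map_zero _)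
  have hM0 : frac K (maximalIdeal R) ≠ ⊥ := by
    rw [← hx.span_mul_scaledMax]
    exact span_singleton_mul_ne_bot hx.ne_zero (by simpa using hx.pow_ne_bot 1)
  rw [hilbertFun_eq_len (K := K), ← len_span_singleton_mul_self hx0
    (CurveSing.pow_fg (frac_fg (maximalIdeal R)) n) (CurveSing.pow_ne_bot hM0 n)]
  have h1 : len (scaledMax K x ^ (n + 1)) (scaledMax K x ^ n) =
      len (frac K (maximalIdeal R) ^ (n + 1))
        (Submodule.span R {algebraMap R K x} * frac K (maximalIdeal R) ^ n) := by
    rw [← len_span_singleton_mul (pow_ne_zero (n + 1) hx.ne_zero) (hx.pow_mono n.le_succ),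
      hx.span_pow_mul_pow, ← hx.span_pow_mul_pow n, ← mul_assoc, Submodule.span_mul_span,
      Set.singleton_mul_singleton, ← pow_succ']
  rw [h1]
  refine (len_add ?_ ?_ (CurveSing.pow_fg (frac_fg _) n)
    (span_singleton_mul_ne_bot hx.ne_zero (CurveSing.pow_ne_bot hM0 n))).symm
  · rw [pow_succ]
    exact (mul_le_mul_right (frac_le_one _) _).trans (mul_one _).le
  · rw [pow_succ']
    refine mul_le_mul_left ?_ _
    exact (Submodule.span_singleton_le_iff_mem _ _).2
      ((IsLocalization.mem_coeSubmodule _ _).2 ⟨x, hx.mem, rfl⟩)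

theorem pow_succ_eq_iff (hx : IsMinimalValue K x) (n : ℕ) :
    scaledMax K x ^ (n + 1) = scaledMax K x ^ n ↔
      hilbertFun (maximalIdeal R) n = len 1 (Submodule.span R {algebraMap R K x}) := by
  have h := hx.hilbertFun_add_len n
  constructor
  · intro h1
    rw [h1, len_self] at h
    exact h
  · intro h1
    exact eq_of_len_eq_zero (hx.pow_mono n.le_succ) (scaledMax_pow_fg K x _) (hx.pow_ne_bot _)
      (by omega)

variable [Module.Finite R (integralClosure R K)]

theorem mult_eq (hx : IsMinimalValue K x) :
    mult (maximalIdeal R) = len 1 (Submodule.span R {algebraMap R K x}) := by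
  obtain ⟨k, hk⟩ := hx.exists_pow_succ_eq
  refine mult_eq_of_hilbertFun_eq _ (k := k) fun n hn => (hx.pow_succ_eq_iff n).1 ?_
  rw [pow_eq_of_pow_succ_eq hk hn, pow_eq_of_pow_succ_eq hk (hn.trans n.le_succ)]

/-- The reduction exponent is the index at which the chain `x⁻ⁿ 𝔪ⁿ` becomes stationary. -/
theorem reductionExponent_eq (hx : IsMinimalValue K x) :
    reductionExponent (maximalIdeal R) =
      sInf {k | scaledMax K x ^ (k + 1) = scaledMax K x ^ k} := by
  rw [reductionExponent]
  congr 1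
  ext k
  constructor
  · rintro ⟨y, hy, hyk⟩
    have hyk' : ∀ n ≥ k, frac K (maximalIdeal R) ^ (n + 1) =
        Submodule.span R {algebraMap R K y} * frac K (maximalIdeal R) ^ n := by
      intro n hn
      rw [← frac_pow, hyk n hn, ← frac_pow, ← IsLocalization.coeSubmodule_span_singleton]
      exact IsLocalization.coeSubmodule_mul K _ _
    have hM0 : frac K (maximalIdeal R) ≠ ⊥ := by
      rw [← hx.span_mul_scaledMax]
      exact span_singleton_mul_ne_bot hx.ne_zero (by simpa using hx.pow_ne_bot 1)
    have hy0 : y ≠ 0 := by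
      rintro rfl
      have := hyk' k le_rfl
      rw [map_zero, Submodule.span_zero_singleton, Submodule.bot_mul] at this
      exact CurveSing.pow_ne_bot hM0 _ this
    -- The reduction y need not be x. It makes H constant from k on, and the constant must be the
    -- eventual value ℓ(R/xR); so the chain built from x is already stationary at k.
    have hH : ∀ n ≥ k, hilbertFun (maximalIdeal R) n =
        len 1 (Submodule.span R {algebraMap R K y}) := by
      intro n hn
      rw [hilbertFun_eq_len (K := K), hyk' n hn, len_span_singleton_mul_self hy0
        (CurveSing.pow_fg (frac_fg (maximalIdeal R)) n) (CurveSing.pow_ne_bot hM0 n)]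
    obtain ⟨j, hj⟩ := hx.exists_pow_succ_eq
    have hjk : hilbertFun (maximalIdeal R) (max k j) =
        len 1 (Submodule.span R {algebraMap R K x}) := by
      refine (hx.pow_succ_eq_iff _).1 ?_
      rw [pow_eq_of_pow_succ_eq hj (le_max_right k j),
        pow_eq_of_pow_succ_eq hj ((le_max_right k j).trans (Nat.le_succ _))]
    refine (hx.pow_succ_eq_iff k).2 ?_
    rw [hH k le_rfl, ← hjk, hH _ (le_max_left k j)]
  · intro hk
    refine ⟨x, hx.mem, fun n hn => ?_⟩
    apply IsFractionRing.coeSubmodule_injective R K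
    change frac K _ = frac K _
    have h2 : frac K (Ideal.span {x} * maximalIdeal R ^ n) =
        Submodule.span R {algebraMap R K x} * frac K (maximalIdeal R) ^ n := by
      rw [← frac_pow, ← IsLocalization.coeSubmodule_span_singleton]
      exact IsLocalization.coeSubmodule_mul K _ _
    rw [h2, frac_pow, ← hx.span_pow_mul_pow, ← hx.span_pow_mul_pow n, ← mul_assoc,
      Submodule.span_mul_span, Set.singleton_mul_singleton, ← pow_succ',
      pow_eq_of_pow_succ_eq hk hn, pow_eq_of_pow_succ_eq hk (hn.trans n.le_succ)]

theorem pow_reductionExponent_succ (hx : IsMinimalValue K x) :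
    scaledMax K x ^ (reductionExponent (maximalIdeal R) + 1) =
      scaledMax K x ^ reductionExponent (maximalIdeal R) := by
  rw [hx.reductionExponent_eq]
  exact Nat.sInf_mem hx.exists_pow_succ_eq

theorem pow_succ_ne (hx : IsMinimalValue K x) {n : ℕ}
    (hn : n < reductionExponent (maximalIdeal R)) :
    scaledMax K x ^ (n + 1) ≠ scaledMax K x ^ n := by
  rw [hx.reductionExponent_eq] at hn
  exact Nat.notMem_of_lt_sInf hn

theorem blowup_eq_pow_reductionExponent (hx : IsMinimalValue K x) :
    blowup K (maximalIdeal R) = scaledMax K x ^ reductionExponent (maximalIdeal R) :=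
  hx.blowup_eq hx.pow_reductionExponent_succ

end Noetherian

end IsMinimalValue

end Reduction

/-! ### Gorenstein means type one -/

section TypeOne

variable {R : Type*} [CommRing R] {K : Type*} [Field K] [Algebra R K]

theorem one_le_dual_frac (I : Ideal R) : 1 ≤ dual (frac K I) := by
  rw [dual, Submodule.le_div_iff_mul_le, one_mul]
  exact frac_le_one I

variable [IsLocalRing R]

/-- If `R` has type one, dualizing a simple quotient gives a quotient of length at most one. -/
theorem qlen_dual_le_one_of_covBy (h1 : 1 ⋖ dual (frac K (maximalIdeal R)))
    {I J : Submodule R K} (h : J ⋖ I) : qlen (dual J) (dual I) ≤ 1 := by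
  have hle : dual I ≤ dual J := div_anti_right 1 h.1.le
  obtain ⟨y, hyI, hyJ⟩ := SetLike.exists_of_lt h.1
  have hsup : J ⊔ Submodule.span R {y} = I := by
    refine (h.eq_or_eq le_sup_left (sup_le h.1.le
      ((Submodule.span_singleton_le_iff_mem _ _).2 hyI))).resolve_left fun he => hyJ ?_
    exact (Submodule.span_singleton_le_iff_mem _ _).1 (sup_eq_left.1 he)
  have hyA : ∀ a ∈ dual J, y * a ∈ dual (frac K (maximalIdeal R)) := by
    intro a ha
    refine Submodule.mem_div_iff_forall_mul_mem.2 fun w hw => ?_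
    obtain ⟨r, hr, rfl⟩ := (IsLocalization.mem_coeSubmodule _ _).1 hw
    have := Submodule.mem_div_iff_forall_mul_mem.1 ha _ (smul_mem_of_covBy h hr hyI)
    rw [Algebra.smul_def] at this
    convert this using 1
    ring
  -- Thus multiplication by y embeds J*/I* into the simple module (R : 𝔪)/R.
  have hC : ∀ a ∈ dual J, y * a ∈ (1 : Submodule R K) → a ∈ dual I := by
    intro a ha hya
    rw [← hsup]
    refine Submodule.mem_div_iff_forall_mul_mem.2 fun w hw => ?_
    obtain ⟨b, hb, z, hz, rfl⟩ := Submodule.mem_sup.1 hw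
    obtain ⟨s, rfl⟩ := Submodule.mem_span_singleton.1 hz
    rw [mul_add, mul_smul_comm, mul_comm a y]
    exact add_mem (Submodule.mem_div_iff_forall_mul_mem.1 ha b hb) (Submodule.smul_mem _ _ hya)
  rcases eq_or_lt_of_le hle with he | hlt
  · rw [he, qlen_eq_zero_iff.2 le_rfl]
    exact zero_le_one
  refine ((qlen_eq_one_iff hle).2 ⟨hlt, fun D hCD hDA => ?_⟩).le
  have hE : Submodule.span R {y} * D ⊔ 1 ≤ dual (frac K (maximalIdeal R)) := by
    refine sup_le (fun w hw => ?_) h1.1.le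
    obtain ⟨d, hd, rfl⟩ := Submodule.mem_span_singleton_mul.1 hw
    exact hyA d (hDA.le hd)
  rcases h1.eq_or_eq le_sup_right hE with he | he
  · refine hCD.not_ge fun d hd => hC d (hDA.le hd) ?_
    exact sup_eq_right.1 he (Submodule.mem_span_singleton_mul.2 ⟨d, hd, rfl⟩)
  · refine hDA.not_ge fun a ha => ?_
    have := hyA a ha
    rw [← he] at this
    obtain ⟨w, hw, s, hs, hws⟩ := Submodule.mem_sup.1 this
    obtain ⟨d, hd, rfl⟩ := Submodule.mem_span_singleton_mul.1 hw
    have hsub : a - d ∈ D := hCD.le (hC _ (sub_mem ha (hDA.le hd)) (by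
      rw [mul_sub, ← hws, add_sub_cancel_left]; exact hs))
    simpa using add_mem hsub hd

theorem hilbertFun_maximalIdeal_zero : hilbertFun (maximalIdeal R) 0 = 1 := by
  have h : qlen (⊤ : Ideal R) (maximalIdeal R) = 1 := by
    rw [qlen_eq_one_iff le_top, covBy_top_iff]
    exact (maximalIdeal.isMaximal R).out
  rw [hilbertFun, pow_zero, zero_add, pow_one, Ideal.one_eq_top, len_eq_toNat_qlen, h]
  rfl

variable [IsDomain R] [IsFractionRing R K]

theorem len_one_frac_maximalIdeal : len (1 : Submodule R K) (frac K (maximalIdeal R)) = 1 := by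
  have := hilbertFun_eq_len (K := K) (maximalIdeal R) 0
  rwa [hilbertFun_maximalIdeal_zero, pow_zero, zero_add, pow_one, eq_comm] at this

variable [IsNoetherianRing R]

theorem IsGorenstein.len_dual_eq_one (h : IsGorenstein R K) (hm : frac K (maximalIdeal R) ≠ ⊥) :
    len (dual (frac K (maximalIdeal R))) 1 = 1 := by
  have := IsCanonicalIdeal.len_div_div h (frac_le_one (K := K) (maximalIdeal R)) one_fg hm
  rwa [div_one_eq, len_one_frac_maximalIdeal] at this

variable [Ring.KrullDimLE 1 R]

/-- Dévissage: both lengths add along a refinement of J ⊆ I, and the simple case is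
`qlen_dual_le_one_of_covBy`. -/
theorem len_dual_le (h1 : 1 ⋖ dual (frac K (maximalIdeal R))) {I J : Submodule R K} (h : J ≤ I)
    (hI : I.FG) (hJ : J ≠ ⊥) : len (dual J) (dual I) ≤ len I J := by
  induction hn : len I J using Nat.strong_induction_on generalizing I J with
  | _ n ih =>
    subst hn
    rcases eq_or_lt_of_le h with rfl | hlt
    · rw [len_self, len_self]
    by_cases hcov : J ⋖ I
    · rw [(len_eq_one_iff h hI hJ).2 hcov]
      have := qlen_dual_le_one_of_covBy h1 hcov
      rw [← coe_len (A := dual J) (B := dual I) (div_anti_right 1 h) (div_fg one_fg hJ)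
        (div_ne_bot one_ne_bot hI)] at this
      exact_mod_cast this
    · obtain ⟨L, hJL, hLI⟩ := (not_covBy_iff hlt).1 hcov
      have hL := ne_bot_of_le hJ hJL.le
      have hadd := len_add hLI.le hJL.le hI hJ
      have hLfg := fg_of_le hI hLI.le
      have p1 : len I L ≠ 0 := fun h0 => hLI.ne' (eq_of_len_eq_zero hLI.le hI hL h0)
      have p2 : len L J ≠ 0 := fun h0 => hJL.ne' (eq_of_len_eq_zero hJL.le hLfg hJ h0)
      have q1 := ih _ (by omega) hLI.le hI hL rfl
      have q2 := ih _ (by omega) hJL.le hLfg hJ rfl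
      have : len (dual J) (dual I) = len (dual J) (dual L) + len (dual L) (dual I) :=
        len_add (div_anti_right 1 hJL.le) (div_anti_right 1 hLI.le) (div_fg one_fg hJ)
          (div_ne_bot one_ne_bot hI)
      omega

/-- For 0 ≠ y ∈ I, dualizing Ry ⊆ I twice does not increase length. As Ry is reflexive, ℓ(I**/Ry) ≤
ℓ(I/Ry), and I ⊆ I** forces equality. -/
theorem isGorenstein_of_len_dual_eq_one (hm : frac K (maximalIdeal R) ≠ ⊥)
    (h : len (dual (frac K (maximalIdeal R))) 1 = 1) : IsGorenstein R K := by
  have h1 := (len_eq_one_iff (one_le_dual_frac (maximalIdeal R)) (div_fg one_fg hm)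
    one_ne_bot).1 h
  refine ⟨one_ne_bot, one_fg, fun I hI hIfg => ?_⟩
  obtain ⟨y, hyI, hy0⟩ := Submodule.exists_mem_ne_zero_of_ne_bot hI
  have hY : Submodule.span R {y} ≤ I := (Submodule.span_singleton_le_iff_mem _ _).2 hyI
  have hY0 : Submodule.span R {y} ≠ ⊥ := by simpa using hy0
  have hdd : dual (dual (Submodule.span R {y})) = Submodule.span R {y} := by
    have e1 : dual (Submodule.span R {y}) = Submodule.span R {y⁻¹} := by
      have := span_singleton_mul_div (R := R) (inv_ne_zero hy0) 1 1
      rwa [inv_inv, mul_one, div_one_eq, mul_one] at this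
    have e2 : dual (Submodule.span R {y⁻¹}) = Submodule.span R {y} := by
      have := span_singleton_mul_div (R := R) hy0 1 1
      rwa [mul_one, div_one_eq, mul_one] at this
    rw [e1, e2]
  have i1 := len_dual_le h1 hY hIfg hY0
  have i2 := len_dual_le h1 (div_anti_right 1 hY) (div_fg one_fg hY0)
    (div_ne_bot one_ne_bot hIfg)
  change len (dual (dual I)) (dual (dual (Submodule.span R {y}))) ≤
    len (dual (Submodule.span R {y})) (dual I) at i2
  rw [hdd] at i2
  have hfg : (dual (dual I)).FG := div_fg one_fg (div_ne_bot one_ne_bot hIfg)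
  have i3 := len_add (le_div_div 1 I) hY hfg hY0
  exact eq_of_len_eq_zero (le_div_div 1 I) hfg hI (by
    change len (dual (dual I)) I = 0
    change len (dual (dual I)) (Submodule.span R {y}) = len (dual (dual I)) I + _ at i3
    omega)

end TypeOne

/-! ### Consequences of the simplicity of N²/N: lengths of Λ/R and R/(R : Λ) -/

section Main

variable {R : Type*} [CommRing R] {K : Type*} [Field K] [Algebra R K]

section

variable [IsDiscreteValuationRing (integralClosure R K)]

theorem valFil_mul_Rbar_le (k : ℕ) :
    valFil R K k * Rbar R K ≤ valFil R K k := by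
  rw [Submodule.mul_le]
  rintro _ ⟨u, rfl, hu⟩ w hw
  obtain ⟨w, rfl⟩ := mem_Rbar.1 hw
  rw [← Subalgebra.coe_mul]
  refine coe_mem_valFil.2 ?_
  rw [IsDiscreteValuationRing.addVal_mul]
  exact hu.trans le_self_add

theorem pow_mem_valFil {z : K}
    (hz : z ∈ valFil R K 1) (n : ℕ) : z ^ n ∈ valFil R K n := by
  obtain ⟨u, rfl, hu⟩ := hz
  rw [← Subalgebra.coe_pow]
  refine coe_mem_valFil.2 ?_
  rw [IsDiscreteValuationRing.addVal_pow]
  simpa using nsmul_le_nsmul_right hu n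

end

variable [IsLocalRing R] {x : R}

namespace IsMinimalValue

theorem frac_ne_bot (hx : IsMinimalValue K x) : frac K (maximalIdeal R) ≠ ⊥ := by
  rw [← hx.span_mul_scaledMax]
  exact span_singleton_mul_ne_bot hx.ne_zero (ne_bot_of_le one_ne_bot hx.one_le)

theorem mem_frac (hx : IsMinimalValue K x) : algebraMap R K x ∈ frac K (maximalIdeal R) :=
  (IsLocalization.mem_coeSubmodule _ _).2 ⟨x, hx.mem, rfl⟩

/-- `R : x⁻¹𝔪 = x (R : 𝔪)`. -/
theorem dual_scaledMax (hx : IsMinimalValue K x) : dual (scaledMax K x) =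
    Submodule.span R {algebraMap R K x} * dual (frac K (maximalIdeal R)) :=
  span_singleton_mul_div hx.ne_zero 1 _

theorem scaledMax_ne_one (hcov : scaledMax K x ⋖ scaledMax K x ^ 2) : scaledMax K x ≠ 1 := by
  intro h
  rw [h, one_pow] at hcov
  exact hcov.1.ne rfl

/-- If `x⁻²𝔪² / x⁻¹𝔪` is simple, the later quotients of the chain have length at most one. -/
theorem qlen_pow_succ_le_one (hcov : scaledMax K x ⋖ scaledMax K x ^ 2) (n : ℕ) :
    qlen (scaledMax K x ^ (n + 2)) (scaledMax K x ^ (n + 1)) ≤ 1 := by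
  set N := scaledMax K x
  obtain ⟨a, ha, b, hb, hab⟩ : ∃ a ∈ N, ∃ b ∈ N, a * b ∉ N := by
    by_contra! hcon
    exact hcov.1.not_ge (by rw [sq, Submodule.mul_le]; exact hcon)
  have habN : a * b ∈ N ^ 2 := by rw [sq]; exact Submodule.mul_mem_mul ha hb
  have hsup : N ⊔ Submodule.span R {a * b} = N ^ 2 := by
    refine (hcov.eq_or_eq le_sup_left (sup_le hcov.1.le
      ((Submodule.span_singleton_le_iff_mem _ _).2 habN))).resolve_left fun he => hab ?_
    exact (Submodule.span_singleton_le_iff_mem _ _).1 (sup_eq_left.1 he)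
  have hpow : ∀ n, a ^ (n + 1) * b ∈ N ^ (n + 2) := fun n => by
    rw [pow_succ N]
    exact Submodule.mul_mem_mul (Submodule.pow_mem_pow N ha _) hb
  -- Since ab generates N² modulo N, any bc with c ∈ N may be replaced by a multiple of ab; so one
  -- generator suffices at each level.
  have key : ∀ n, N ^ (n + 2) ≤ N ^ (n + 1) ⊔ Submodule.span R {a ^ (n + 1) * b} := by
    intro n
    induction n with
    | zero => simpa using hsup.ge
    | succ n ih =>
      rw [pow_succ, Submodule.mul_le]
      intro p hp c hc
      obtain ⟨q, hq, w, hw, rfl⟩ := Submodule.mem_sup.1 (ih hp)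
      obtain ⟨s, rfl⟩ := Submodule.mem_span_singleton.1 hw
      have hbc : b * c ∈ N ^ 2 := by rw [sq]; exact Submodule.mul_mem_mul hb hc
      rw [← hsup] at hbc
      obtain ⟨d, hd, w', hw', hdw⟩ := Submodule.mem_sup.1 hbc
      obtain ⟨t, rfl⟩ := Submodule.mem_span_singleton.1 hw'
      have e : (q + s • (a ^ (n + 1) * b)) * c =
          (q * c + s • (a ^ (n + 1) * d)) + (s * t) • (a ^ (n + 2) * b) := by
        rw [add_mul, smul_mul_assoc, mul_assoc, ← hdw]
        simp only [Algebra.smul_def, map_mul]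
        ring
      rw [e]
      refine Submodule.add_mem_sup (add_mem ?_ (Submodule.smul_mem _ _ ?_))
        (Submodule.smul_mem _ _ (Submodule.mem_span_singleton_self _))
      · rw [pow_succ N]; exact Submodule.mul_mem_mul hq hc
      · rw [pow_succ N]; exact Submodule.mul_mem_mul (Submodule.pow_mem_pow N ha _) hd
  have hle : N ^ (n + 1) ≤ N ^ (n + 2) := by
    rw [show n + 2 = n + 1 + 1 from rfl, pow_succ N n, pow_succ N (n + 1), pow_succ N n, mul_assoc]
    exact mul_le_mul_right (by rw [← sq]; exact hcov.1.le) _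
  have heq : N ^ (n + 2) = N ^ (n + 1) ⊔ Submodule.span R {a ^ (n + 1) * b} :=
    le_antisymm (key n) (sup_le hle ((Submodule.span_singleton_le_iff_mem _ _).2 (hpow n)))
  rw [heq]
  refine qlen_sup_span_singleton_le_one fun r hr => ?_
  have e : r • (a ^ (n + 1) * b) = a ^ n * r • (a * b) := by
    rw [mul_smul_comm]; congr 1; ring
  rw [e, pow_succ N]
  exact Submodule.mul_mem_mul (Submodule.pow_mem_pow N ha _) (smul_mem_of_covBy hcov hr habN)

section DVR

variable [IsDomain R] [IsFractionRing R K]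

section Chain

variable [IsNoetherianRing R] [Ring.KrullDimLE 1 R] [Module.Finite R (integralClosure R K)]

theorem two_le_reductionExponent (hx : IsMinimalValue K x)
    (hcov : scaledMax K x ⋖ scaledMax K x ^ 2) : 2 ≤ reductionExponent (maximalIdeal R) := by
  by_contra! h
  have h1 := hx.pow_reductionExponent_succ
  refine hcov.1.ne ?_
  rw [pow_eq_of_pow_succ_eq h1 (n := 2) (by omega), ← pow_eq_of_pow_succ_eq h1 (n := 1) (by omega),
    pow_one]

theorem scaledMax_sq_le_blowup (hx : IsMinimalValue K x)
    (hcov : scaledMax K x ⋖ scaledMax K x ^ 2) :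
    scaledMax K x ^ 2 ≤ blowup K (maximalIdeal R) := by
  rw [hx.blowup_eq_pow_reductionExponent]
  exact hx.pow_mono (hx.two_le_reductionExponent hcov)

/-- `ℓ(Λ / R) = e + ν - 2`. -/
theorem len_blowup_one (hx : IsMinimalValue K x)
    (hcov : scaledMax K x ⋖ scaledMax K x ^ 2) :
    len (blowup K (maximalIdeal R)) 1 + 2 =
      len 1 (Submodule.span R {algebraMap R K x}) + reductionExponent (maximalIdeal R) := by
  -- The first quotient N/R contributes e - 1; each later one before ν contributes exactly 1, being
  -- nonzero and of length at most one.
  have key : ∀ n, n + 1 ≤ reductionExponent (maximalIdeal R) →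
      len (scaledMax K x ^ (n + 1)) 1 + 2 =
        len 1 (Submodule.span R {algebraMap R K x}) + (n + 1) := by
    intro n
    induction n with
    | zero =>
      intro _
      have := hx.hilbertFun_add_len 0
      rw [hilbertFun_maximalIdeal_zero, pow_zero] at this
      omega
    | succ n ih =>
      intro hn
      have h1 := len_add (A := scaledMax K x ^ (n + 2)) (B := scaledMax K x ^ (n + 1))
        (hx.pow_mono (n + 1).le_succ) (hx.one_le_pow _)
        (scaledMax_pow_fg K x (n + 2)) one_ne_bot
      have h2 : len (scaledMax K x ^ (n + 2)) (scaledMax K x ^ (n + 1)) ≤ 1 := by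
        have := qlen_pow_succ_le_one hcov n
        rw [← coe_len (hx.pow_mono (n + 1).le_succ) (scaledMax_pow_fg K x _)
          (hx.pow_ne_bot _)] at this
        exact_mod_cast this
      have h3 : len (scaledMax K x ^ (n + 2)) (scaledMax K x ^ (n + 1)) ≠ 0 := fun h0 =>
        hx.pow_succ_ne (n := n + 1) (by omega) (eq_of_len_eq_zero (hx.pow_mono (n + 1).le_succ)
          (scaledMax_pow_fg K x _) (hx.pow_ne_bot _) h0)
      have h4 := ih (by omega)
      change len (scaledMax K x ^ (n + 2)) 1 + 2 = _ + (n + 2)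
      omega
  have h2 := hx.two_le_reductionExponent hcov
  obtain ⟨n, hn⟩ : ∃ n, reductionExponent (maximalIdeal R) = n + 1 :=
    ⟨reductionExponent (maximalIdeal R) - 1, by omega⟩
  rw [hx.blowup_eq_pow_reductionExponent, hn]
  exact key n hn.ge

end Chain

variable [IsDiscreteValuationRing (integralClosure R K)]

/-- `R : 𝔪 = 𝔪 : 𝔪` when `𝔪` is not principal. -/
theorem mul_mem_frac (hx : IsMinimalValue K x) (hne : scaledMax K x ≠ 1) {z y : K}
    (hz : z ∈ dual (frac K (maximalIdeal R))) (hy : y ∈ frac K (maximalIdeal R)) :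
    z * y ∈ frac K (maximalIdeal R) := by
  have hz' := Submodule.mem_div_iff_forall_mul_mem.1 hz
  obtain ⟨r, hr⟩ := Submodule.mem_one.1 (hz' y hy)
  by_cases hrm : r ∈ maximalIdeal R
  · exact (IsLocalization.mem_coeSubmodule _ _).2 ⟨r, hrm, hr⟩
  -- Otherwise zy is a unit of R, which makes 𝔪 = yR. Write x = sy; minimality of the value of x
  -- makes s a unit, so 𝔪 = xR and N = R.
  exfalso
  obtain ⟨r, rfl⟩ : IsUnit r := by simpa using hrm
  have hr0 : algebraMap R K r ≠ 0 := by simp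
  have hy0 : y ≠ 0 := by rintro rfl; rw [mul_zero] at hr; exact hr0 hr
  have hM : frac K (maximalIdeal R) ≤ Submodule.span R {y} := by
    intro w hw
    obtain ⟨t, ht⟩ := Submodule.mem_one.1 (hz' w hw)
    refine Submodule.mem_span_singleton.2 ⟨(↑r⁻¹ : R) * t, ?_⟩
    rw [Algebra.smul_def, map_mul, ht]
    have : algebraMap R K (↑r⁻¹ : R) * algebraMap R K r = 1 := by
      rw [← map_mul, Units.inv_mul, map_one]
    calc algebraMap R K (↑r⁻¹ : R) * (z * w) * y
        = algebraMap R K (↑r⁻¹ : R) * (z * y) * w := by ring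
      _ = w := by rw [← hr, this, one_mul]
  obtain ⟨s, hs⟩ := Submodule.mem_span_singleton.1 (hM hx.mem_frac)
  rw [Algebra.smul_def] at hs
  have hyN : (algebraMap R K x)⁻¹ * y ∈ scaledMax K x :=
    Submodule.mem_span_singleton_mul.2 ⟨y, hy, rfl⟩
  have hsm : s ∉ maximalIdeal R := by
    intro hsm
    have h1 := valFil_mul_Rbar_le 1 (Submodule.mul_mem_mul
      (algebraMap_mem_valFil_one_iff (K := K).2 hsm) (hx.le hyN))
    rw [mul_left_comm, hs, inv_mul_cancel₀ hx.ne_zero, ← map_one (algebraMap R K)] at h1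
    exact (Ideal.ne_top_iff_one _).1 (maximalIdeal.isMaximal R).ne_top
      (algebraMap_mem_valFil_one_iff.1 h1)
  obtain ⟨s, rfl⟩ : IsUnit s := by simpa using hsm
  refine hne (le_antisymm (fun w hw => ?_) hx.one_le)
  obtain ⟨w', hw', rfl⟩ := Submodule.mem_span_singleton_mul.1 hw
  obtain ⟨t, rfl⟩ := Submodule.mem_span_singleton.1 (hM hw')
  refine Submodule.mem_one.2 ⟨t * (↑s⁻¹ : R), ?_⟩
  have hsinv : algebraMap R K (↑s⁻¹ : R) * algebraMap R K s = 1 := by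
    rw [← map_mul, Units.inv_mul, map_one]
  rw [← hs, Algebra.smul_def, map_mul]
  have hs0 : algebraMap R K (s : R) ≠ 0 := by simp
  field_simp
  linear_combination algebraMap R K t * hsinv

theorem dual_frac_le_scaledMax (hx : IsMinimalValue K x) (hne : scaledMax K x ≠ 1) :
    dual (frac K (maximalIdeal R)) ≤ scaledMax K x := fun z hz =>
  Submodule.mem_span_singleton_mul.2 ⟨z * algebraMap R K x, hx.mul_mem_frac hne hz hx.mem_frac,
    by rw [mul_left_comm, inv_mul_cancel₀ hx.ne_zero, mul_one]⟩

theorem span_mul_scaledMax_le (hx : IsMinimalValue K x) (hne : scaledMax K x ≠ 1) {z : K}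
    (hz : z ∈ dual (frac K (maximalIdeal R))) :
    Submodule.span R {z} * scaledMax K x ≤ scaledMax K x := by
  intro w hw
  obtain ⟨y, hy, rfl⟩ := Submodule.mem_span_singleton_mul.1 hw
  obtain ⟨v, hv, rfl⟩ := Submodule.mem_span_singleton_mul.1 hy
  exact Submodule.mem_span_singleton_mul.2 ⟨z * v, hx.mul_mem_frac hne hz hv, by ring⟩

theorem dual_frac_inf_valFil_ne_bot (hx : IsMinimalValue K x) :
    dual (frac K (maximalIdeal R)) ⊓ valFil R K 1 ≠ ⊥ :=
  (Submodule.ne_bot_iff _).2 ⟨algebraMap R K x,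
    ⟨one_le_dual_frac _ (frac_le_one _ hx.mem_frac), algebraMap_mem_valFil_one_iff.2 hx.mem⟩,
    hx.ne_zero⟩

theorem len_dual_frac_inf_valFil (hx : IsMinimalValue K x) (hrat : ResiduallyRational R K)
    (hne : scaledMax K x ≠ 1) :
    len (dual (frac K (maximalIdeal R))) (dual (frac K (maximalIdeal R)) ⊓ valFil R K 1) = 1 := by
  classical
  rw [len_inf_valFil hrat ((hx.dual_frac_le_scaledMax hne).trans hx.le), Nat.count_succ,
    Nat.count_zero, if_pos (values_mono (one_le_dual_frac _) zero_mem_values_one)]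

variable [Module.Finite R (integralClosure R K)]

/-- Elements of positive value in `R : 𝔪` act nilpotently, hence trivially, on the simple quotient
`x⁻²𝔪² / x⁻¹𝔪`. -/
theorem span_mul_sq_le (hx : IsMinimalValue K x) (hcov : scaledMax K x ⋖ scaledMax K x ^ 2)
    {z : K} (hz : z ∈ dual (frac K (maximalIdeal R))) (hz1 : z ∈ valFil R K 1) :
    Submodule.span R {z} * scaledMax K x ^ 2 ≤ scaledMax K x := by
  have hne := scaledMax_ne_one hcov
  have hzN := hx.span_mul_scaledMax_le hne hz
  set N := scaledMax K x
  have hzN2 : Submodule.span R {z} * N ^ 2 ≤ N ^ 2 := by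
    rw [sq, ← mul_assoc]
    exact mul_le_mul_left hzN _
  rcases hcov.eq_or_eq (c := Submodule.span R {z} * N ^ 2 ⊔ N) le_sup_right
    (sup_le hzN2 hcov.1.le) with he | he
  · exact sup_eq_right.1 he
  exfalso
  -- If z acted nontrivially on N²/N it would act surjectively, and so would all its powers; but z^c
  -- lies in the conductor and sends N² into R ⊆ N.
  have hiter : ∀ j, N ^ 2 ≤ Submodule.span R {z ^ j} * N ^ 2 ⊔ N := by
    intro j
    induction j with
    | zero => rw [pow_zero, ← Submodule.one_eq_span, one_mul]; exact le_sup_left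
    | succ j ih =>
      calc N ^ 2 ≤ Submodule.span R {z} * N ^ 2 ⊔ N := he.ge
        _ ≤ Submodule.span R {z} * (Submodule.span R {z ^ j} * N ^ 2 ⊔ N) ⊔ N :=
          sup_le_sup_right (mul_le_mul_right ih _) _
        _ = Submodule.span R {z ^ (j + 1)} * N ^ 2 ⊔ (Submodule.span R {z} * N ⊔ N) := by
          rw [Submodule.mul_sup, ← mul_assoc, Submodule.span_mul_span,
            Set.singleton_mul_singleton, ← pow_succ', sup_assoc]
        _ = Submodule.span R {z ^ (j + 1)} * N ^ 2 ⊔ N := by rw [sup_eq_right.2 hzN]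
  obtain ⟨c, hc, -⟩ := exists_condIdeal_eq R K
  have hzc : Submodule.span R {z ^ c} * N ^ 2 ≤ N := by
    refine le_trans (Submodule.mul_le.2 fun a ha b hb => ?_) hx.one_le
    have ha' : a ∈ condIdeal R K :=
      hc ▸ (Submodule.span_singleton_le_iff_mem _ _).2 (pow_mem_valFil hz1 c) ha
    exact Submodule.mem_div_iff_forall_mul_mem.1 ha' b (hx.pow_le_Rbar 2 hb)
  exact hcov.1.not_ge ((hiter c).trans (sup_le hzc le_rfl))

/-- The elements of positive value in `R : 𝔪` form an ideal of the blowing-up. -/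
theorem inf_valFil_mul_pow_le (hx : IsMinimalValue K x)
    (hcov : scaledMax K x ⋖ scaledMax K x ^ 2) (n : ℕ) :
    (dual (frac K (maximalIdeal R)) ⊓ valFil R K 1) * scaledMax K x ^ n ≤
      dual (frac K (maximalIdeal R)) ⊓ valFil R K 1 := by
  have hstep : (dual (frac K (maximalIdeal R)) ⊓ valFil R K 1) * scaledMax K x ≤
      dual (frac K (maximalIdeal R)) ⊓ valFil R K 1 := by
    rw [Submodule.mul_le]
    rintro z ⟨hz, hz1⟩ y hy
    refine ⟨Submodule.mem_div_iff_forall_mul_mem.2 fun w hw => ?_,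
      valFil_mul_Rbar_le 1 (Submodule.mul_mem_mul hz1 (hx.le hy))⟩
    rw [← hx.span_mul_scaledMax] at hw
    obtain ⟨v, hv, rfl⟩ := Submodule.mem_span_singleton_mul.1 hw
    -- Here zy𝔪 = x(zyN) ⊆ x(zN²) ⊆ xN = 𝔪.
    have hyv : y * v ∈ scaledMax K x ^ 2 := by rw [sq]; exact Submodule.mul_mem_mul hy hv
    have h := hx.span_mul_sq_le hcov hz hz1
      (Submodule.mem_span_singleton_mul.2 ⟨y * v, hyv, rfl⟩)
    refine frac_le_one (maximalIdeal R) ?_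
    rw [← hx.span_mul_scaledMax]
    exact Submodule.mem_span_singleton_mul.2 ⟨_, h, by ring⟩
  induction n with
  | zero => rw [pow_zero, mul_one]
  | succ n ih =>
    rw [pow_succ, ← mul_assoc]
    exact (mul_le_mul_left ih _).trans hstep

/-- Were R : 𝔪 = R, then N𝔪^(k+1) ⊆ R would imply N𝔪^k ⊆ R. Starting from a power of 𝔪 inside the
conductor, one would descend to N ⊆ R. -/
theorem one_lt_dual_frac (hx : IsMinimalValue K x) (hne : scaledMax K x ≠ 1) :
    1 < dual (frac K (maximalIdeal R)) := by
  refine lt_of_le_of_ne (one_le_dual_frac _) fun he => hne (le_antisymm ?_ hx.one_le)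
  have hpow : ∀ k, scaledMax K x * frac K (maximalIdeal R) ^ k ≤ 1 → scaledMax K x ≤ 1 := by
    intro k
    induction k with
    | zero => simp
    | succ k ih =>
      intro h
      refine ih ?_
      rw [he, dual, Submodule.le_div_iff_mul_le, mul_assoc, ← pow_succ]
      exact h
  obtain ⟨c, hc, -⟩ := exists_condIdeal_eq R K
  have hMc : ∀ k, frac K (maximalIdeal R) ^ k ≤ valFil R K k := by
    intro k
    induction k with
    | zero => rw [pow_zero, valFil_zero]; exact one_le_Rbar
    | succ k ih =>
      rw [pow_succ, Submodule.mul_le]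
      intro a ha b hb
      rw [frac_maximalIdeal] at hb
      obtain ⟨u, rfl, hu⟩ := ih ha
      obtain ⟨w, rfl, hw⟩ := hb.2
      rw [← Subalgebra.coe_mul]
      refine coe_mem_valFil.2 ?_
      rw [IsDiscreteValuationRing.addVal_mul]
      push_cast at hw ⊢
      exact add_le_add hu hw
  refine hpow c (Submodule.mul_le.2 fun a ha b hb => ?_)
  rw [mul_comm]
  exact Submodule.mem_div_iff_forall_mul_mem.1 (hc ▸ hMc c hb : b ∈ condIdeal R K) a (hx.le ha)

variable [IsNoetherianRing R] [Ring.KrullDimLE 1 R]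

/-- `R : Λ` consists of the elements `x z` with `z ∈ R : 𝔪` of positive value. -/
theorem dual_blowup_eq (hx : IsMinimalValue K x) (hrat : ResiduallyRational R K)
    (hcov : scaledMax K x ⋖ scaledMax K x ^ 2) :
    dual (blowup K (maximalIdeal R)) = Submodule.span R {algebraMap R K x} *
      (dual (frac K (maximalIdeal R)) ⊓ valFil R K 1) := by
  have hne := scaledMax_ne_one hcov
  have hX0 := hx.ne_zero
  have hXB1 : Submodule.span R {algebraMap R K x} * dual (frac K (maximalIdeal R)) ≤ 1 := by
    rw [← hx.dual_scaledMax]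
    exact (div_anti_right 1 hx.one_le).trans (div_one_eq 1).le
  have hΛ := hx.scaledMax_sq_le_blowup hcov
  have hge : Submodule.span R {algebraMap R K x} *
      (dual (frac K (maximalIdeal R)) ⊓ valFil R K 1) ≤ dual (blowup K (maximalIdeal R)) := by
    refine Submodule.le_div_iff_mul_le.2 ?_
    rw [hx.blowup_eq_pow_reductionExponent, mul_assoc]
    exact (mul_le_mul_right ((hx.inf_valFil_mul_pow_le hcov _).trans inf_le_left) _).trans hXB1
  have hle : dual (blowup K (maximalIdeal R)) ≤
      Submodule.span R {algebraMap R K x} * dual (frac K (maximalIdeal R)) := by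
    rw [← hx.dual_scaledMax]
    exact div_anti_right 1 (hcov.1.le.trans hΛ)
  have hBcov := (len_eq_one_iff
    (mul_le_mul_right inf_le_left (Submodule.span R {algebraMap R K x}))
    ((Submodule.fg_span_singleton _).mul (div_fg one_fg hx.frac_ne_bot))
    (span_singleton_mul_ne_bot hX0 (hx.dual_frac_inf_valFil_ne_bot))).1
    ((len_span_singleton_mul hX0 inf_le_left).trans (hx.len_dual_frac_inf_valFil hrat hne))
  -- R : Λ lies between xB₊ and x(R : 𝔪), with no module strictly between. The upper bound would put
  -- x in R : Λ, so xN² ⊆ 𝔪 = xN, against N ≠ N².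
  refine (hBcov.eq_or_eq hge hle).resolve_right fun he => hcov.1.not_ge ?_
  have hXmem : algebraMap R K x ∈ dual (blowup K (maximalIdeal R)) := by
    rw [he]
    exact Submodule.mem_span_singleton_mul.2
      ⟨1, Submodule.one_le.1 (one_le_dual_frac _), mul_one _⟩
  rw [← span_singleton_mul_le_iff hX0, hx.span_mul_scaledMax, frac_maximalIdeal]
  intro w hw
  obtain ⟨v, hv, rfl⟩ := Submodule.mem_span_singleton_mul.1 hw
  refine ⟨Submodule.mem_div_iff_forall_mul_mem.1 hXmem v (hΛ hv),
    valFil_mul_Rbar_le 1 (Submodule.mul_mem_mul ?_ (hx.pow_le_Rbar 2 hv))⟩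
  exact algebraMap_mem_valFil_one_iff.2 hx.mem

/-- `ℓ(R / (R : Λ)) = e - r + 1`, where `r` is the type of `R`. -/
theorem len_one_dual_blowup (hx : IsMinimalValue K x) (hrat : ResiduallyRational R K)
    (hcov : scaledMax K x ⋖ scaledMax K x ^ 2) :
    len 1 (dual (blowup K (maximalIdeal R))) + len (dual (frac K (maximalIdeal R))) 1 =
      len 1 (Submodule.span R {algebraMap R K x}) + 1 := by
  have hne := scaledMax_ne_one hcov
  have hX0 := hx.ne_zero
  have hXB1 : Submodule.span R {algebraMap R K x} * dual (frac K (maximalIdeal R)) ≤ 1 := by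
    rw [← hx.dual_scaledMax]
    exact (div_anti_right 1 hx.one_le).trans (div_one_eq 1).le
  -- In R ⊇ x(R : 𝔪), going on down to xR costs r and gives total e, while going on down to xB₊
  -- costs one.
  have h1 := len_add hXB1 (mul_le_mul_right (one_le_dual_frac (maximalIdeal R)) _) one_fg
    (span_singleton_mul_ne_bot hX0 one_ne_bot)
  rw [len_span_singleton_mul hX0 (one_le_dual_frac _), mul_one] at h1
  have h2 := len_add hXB1 (mul_le_mul_right
    (inf_le_left : dual (frac K (maximalIdeal R)) ⊓ valFil R K 1 ≤ _) _) one_fg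
    (span_singleton_mul_ne_bot hX0 (hx.dual_frac_inf_valFil_ne_bot))
  rw [len_span_singleton_mul hX0 inf_le_left, hx.len_dual_frac_inf_valFil hrat hne] at h2
  rw [hx.dual_blowup_eq hrat hcov]
  omega

end DVR

end IsMinimalValue

end Main

/-! ### The three assertions -/

section Final

variable {R : Type*} [CommRing R] [IsDomain R] [IsNoetherianRing R] [IsLocalRing R]
  [Ring.KrullDimLE 1 R] {K : Type*} [Field K] [Algebra R K] [IsFractionRing R K] {x : R}

namespace IsMinimalValue

/-- ℓ(R/𝔪²) = 1 + μ, and μ = e - 1 because ℓ(N²/N) = 1. -/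
theorem len_one_frac_sq (hx : IsMinimalValue K x)
    (hcov : scaledMax K x ⋖ scaledMax K x ^ 2) :
    len 1 (frac K (maximalIdeal R) ^ 2) = len 1 (Submodule.span R {algebraMap R K x}) := by
  have hM1 := frac_le_one (K := K) (maximalIdeal R)
  have hM2 : frac K (maximalIdeal R) ^ 2 ≤ frac K (maximalIdeal R) := by
    rw [sq]; exact (mul_le_mul_right hM1 _).trans (mul_one _).le
  rw [len_add hM1 hM2 one_fg (CurveSing.pow_ne_bot hx.frac_ne_bot 2),
    len_one_frac_maximalIdeal]
  have h := hx.hilbertFun_add_len 1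
  have h1 := (len_eq_one_iff hcov.1.le (scaledMax_pow_fg K x 2)
    (ne_bot_of_le one_ne_bot hx.one_le)).2 hcov
  rw [hilbertFun_eq_len (K := K)] at h
  norm_num at h
  omega

variable [Module.Finite R (integralClosure R K)]

/-- For `e = μ + 1`, the quotient `x⁻²𝔪² / x⁻¹𝔪` is simple. -/
theorem covBy_of_mult_eq (hx : IsMinimalValue K x)
    (he : mult (maximalIdeal R) = (embDim R : ℤ) + 1) :
    scaledMax K x ⋖ scaledMax K x ^ 2 := by
  rw [hx.mult_eq, embDim_eq_hilbertFun] at he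
  have h := hx.hilbertFun_add_len 1
  have h1 : len (scaledMax K x ^ 2) (scaledMax K x) = 1 := by
    rw [pow_one] at h
    norm_num at h
    omega
  have hle : scaledMax K x ≤ scaledMax K x ^ 2 := by
    simpa using hx.pow_mono one_le_two
  exact (len_eq_one_iff hle (scaledMax_pow_fg K x 2) (ne_bot_of_le one_ne_bot hx.one_le)).1 h1

theorem one_le_blowup (hx : IsMinimalValue K x) : 1 ≤ blowup K (maximalIdeal R) := by
  rw [hx.blowup_eq_pow_reductionExponent]
  exact hx.one_le_pow _

theorem blowup_le_Rbar (hx : IsMinimalValue K x) : blowup K (maximalIdeal R) ≤ Rbar R K := by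
  rw [hx.blowup_eq_pow_reductionExponent]
  exact hx.pow_le_Rbar _

theorem frac_pow_le_dual_blowup (hx : IsMinimalValue K x) :
    frac K (maximalIdeal R) ^ reductionExponent (maximalIdeal R) ≤
      dual (blowup K (maximalIdeal R)) := by
  refine Submodule.le_div_iff_mul_le.2 ?_
  rw [hx.blowup_eq_pow_reductionExponent, ← hx.span_pow_mul_pow, mul_assoc, ← pow_add,
    pow_eq_of_pow_succ_eq hx.pow_reductionExponent_succ (Nat.le_add_left _ _),
    hx.span_pow_mul_pow]
  exact pow_le_one' (frac_le_one _) _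

variable [IsDiscreteValuationRing (integralClosure R K)]

theorem dual_blowup_eq_frac_pow_iff (hx : IsMinimalValue K x) (hrat : ResiduallyRational R K)
    (hcov : scaledMax K x ⋖ scaledMax K x ^ 2) :
    dual (blowup K (maximalIdeal R)) =
        frac K (maximalIdeal R) ^ reductionExponent (maximalIdeal R) ↔
      IsGorenstein R K ∧ reductionExponent (maximalIdeal R) = 2 := by
  have hM0 := hx.frac_ne_bot
  have hM1 := frac_le_one (K := K) (maximalIdeal R)
  have hsq := hx.len_one_frac_sq hcov
  have hD := hx.len_one_dual_blowup hrat hcov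
  have hD1 : dual (blowup K (maximalIdeal R)) ≤ 1 :=
    (div_anti_right 1 hx.one_le_blowup).trans (div_one_eq 1).le
  constructor
  · intro h
    have hν := hx.two_le_reductionExponent hcov
    have hr : len (dual (frac K (maximalIdeal R))) 1 ≠ 0 := fun h0 =>
      (hx.one_lt_dual_frac (scaledMax_ne_one hcov)).ne' (eq_of_len_eq_zero
        (one_le_dual_frac _) (div_fg one_fg hM0) one_ne_bot h0)
    have hle : frac K (maximalIdeal R) ^ reductionExponent (maximalIdeal R) ≤
        frac K (maximalIdeal R) ^ 2 := pow_le_pow_right_of_le_one' hM1 hν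
    have hadd := len_add (pow_le_one' hM1 2) hle one_fg (CurveSing.pow_ne_bot hM0 _)
    rw [h] at hD
    -- ℓ(R/𝔪^ν) = e + 1 - r is at least ℓ(R/𝔪²) = e, and r ≠ 0; so r = 1.
    refine ⟨isGorenstein_of_len_dual_eq_one hM0 (by omega), ?_⟩
    have h2 : frac K (maximalIdeal R) ^ 2 =
        frac K (maximalIdeal R) ^ reductionExponent (maximalIdeal R) :=
      eq_of_len_eq_zero hle (CurveSing.pow_fg (frac_fg _) 2) (CurveSing.pow_ne_bot hM0 _)
        (by omega)
    by_contra hne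
    -- If ν > 2, then 𝔪³ is squeezed between 𝔪^ν = 𝔪² and 𝔪². Then H(2) = 0, so e = ℓ(N³/N²) ≤ 1 and
    -- ℓ(N/R) = e - 1 = 0, contradicting N ≠ R.
    have h3 : frac K (maximalIdeal R) ^ 2 = frac K (maximalIdeal R) ^ 3 :=
      le_antisymm (h2.le.trans (pow_le_pow_right_of_le_one' hM1 (by omega)))
        (pow_le_pow_right_of_le_one' hM1 (by omega))
    have h4 := hx.hilbertFun_add_len 2
    rw [hilbertFun_eq_len (K := K), ← h3, len_self] at h4
    have h5 := qlen_pow_succ_le_one hcov 1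
    rw [← coe_len (hx.pow_mono (Nat.le_succ 2)) (scaledMax_pow_fg K x 3) (hx.pow_ne_bot 2)] at h5
    have h5 : len (scaledMax K x ^ 3) (scaledMax K x ^ 2) ≤ 1 := by exact_mod_cast h5
    have h6 := hx.hilbertFun_add_len 0
    rw [hilbertFun_maximalIdeal_zero, zero_add, pow_one, pow_zero] at h6
    norm_num at h4
    exact scaledMax_ne_one hcov (eq_of_len_eq_zero hx.one_le (by
      simpa using scaledMax_pow_fg K x 1) one_ne_bot (by omega))
  · rintro ⟨hG, hν⟩
    have hr := hG.len_dual_eq_one hM0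
    have hle := hx.frac_pow_le_dual_blowup
    rw [hν] at hle ⊢
    have hadd := len_add hD1 hle one_fg (CurveSing.pow_ne_bot hM0 2)
    exact eq_of_len_eq_zero hle (fg_of_le one_fg hD1) (CurveSing.pow_ne_bot hM0 2) (by omega)

theorem sum_typeSeq_sub_one (hx : IsMinimalValue K x) (hrat : ResiduallyRational R K)
    (hcov : scaledMax K x ⋖ scaledMax K x ^ 2) :
    ∑ i ∈ (Finset.Icc 1 (numTS R K) \ Gam K (maximalIdeal R)).erase 1,
        ((typeSeq R K i : ℤ) - 1) =
      dInv K (maximalIdeal R) +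
        (len (dual (dual (blowup K (maximalIdeal R)))) (blowup K (maximalIdeal R)) : ℤ) +
        ((reductionExponent (maximalIdeal R) : ℤ) - 2) := by
  classical
  have hne := scaledMax_ne_one hcov
  have hΛ1 := hx.one_le_blowup
  have hΛV := hx.blowup_le_Rbar
  have hsub : Gam K (maximalIdeal R) ⊆ Finset.Icc 1 (numTS R K) := Finset.filter_subset _ _
  -- If n = 0 then the conductor is R, so V = R and N = R.
  have h1n : 1 ≤ numTS R K := by
    refine Nat.one_le_iff_ne_zero.2 fun h0 => hne (le_antisymm ?_ hx.one_le)
    have h1 := eq_of_len_eq_zero condIdeal_le_one one_fg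
      (div_ne_bot one_ne_bot Rbar_fg) h0
    refine hx.le.trans fun v hv => ?_
    have h2 : (1 : K) ∈ condIdeal R K := h1 ▸ Submodule.one_le.1 le_rfl
    simpa using Submodule.mem_div_iff_forall_mul_mem.1 h2 v hv
  -- The index 1 stands for s₀ = 0, but every element of R : Λ = xB₊ has positive value. So deleting
  -- i = 1 from the complement of Γ really removes the term r - 1.
  have h1Γ : 1 ∉ Gam K (maximalIdeal R) := by
    intro h
    have h0 := (Finset.mem_filter.1 h).2
    rw [Nat.sub_self, sElem_zero, hx.dual_blowup_eq hrat hcov] at h0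
    obtain ⟨u, hu, hu0⟩ := h0
    obtain ⟨z, hz, hzu⟩ := Submodule.mem_span_singleton_mul.1 hu
    have h1 : (u : K) ∈ valFil R K 1 := by
      rw [← hzu]
      exact valFil_mul_Rbar_le 1 (Submodule.mul_mem_mul
        (algebraMap_mem_valFil_one_iff.2 hx.mem) (valFil_le_Rbar 1 hz.2))
    have h2 := coe_mem_valFil.1 h1
    rw [hu0] at h2
    simp at h2
  have hmem : 1 ∈ Finset.Icc 1 (numTS R K) \ Gam K (maximalIdeal R) :=
    Finset.mem_sdiff.2 ⟨Finset.mem_Icc.2 ⟨le_rfl, h1n⟩, h1Γ⟩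
  have hs1 := Finset.add_sum_erase _ (fun i => (typeSeq R K i : ℤ) - 1) hmem
  have hs2 := Finset.sum_sdiff (f := fun i => (typeSeq R K i : ℤ) - 1) hsub
  have hs3 : ∑ i ∈ Finset.Icc 1 (numTS R K), ((typeSeq R K i : ℤ) - 1) =
      delta R K - numTS R K := by
    rw [Finset.sum_sub_distrib, ← sum_typeSeq hrat]
    simp
  have hs4 : ∑ i ∈ Gam K (maximalIdeal R), ((typeSeq R K i : ℤ) - 1) =
      ∑ i ∈ Gam K (maximalIdeal R), (typeSeq R K i : ℤ) - (Gam K (maximalIdeal R)).card := by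
    rw [Finset.sum_sub_distrib]
    simp
  have hcard := card_Gam_add_len hrat (maximalIdeal R) hΛ1 hΛV
  have hD := hx.len_one_dual_blowup hrat hcov
  have hΛlen := hx.len_blowup_one hcov
  have hΛΛ : blowup K (maximalIdeal R) ≤ dual (dual (blowup K (maximalIdeal R))) := le_div_div _ _
  have hΛΛV : dual (dual (blowup K (maximalIdeal R))) ≤ Rbar R K := by
    obtain ⟨c, -, hd⟩ := exists_condIdeal_eq R K
    rw [← hd]
    exact div_anti_right 1 (div_anti_right 1 hΛV)
  have hδ := len_add hΛV hΛ1 Rbar_fg one_ne_bot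
  have hδ' := len_add hΛΛV hΛΛ Rbar_fg (ne_bot_of_le one_ne_bot hΛ1)
  have hr1 := typeSeq_one (R := R) (K := K)
  rw [dInv]
  rw [← delta] at hδ
  simp only [hr1] at hs1
  zify at hcard hD hΛlen hδ hδ'
  linarith

theorem isAlmostGorenstein_iff (hx : IsMinimalValue K x) (hrat : ResiduallyRational R K)
    (hcov : scaledMax K x ⋖ scaledMax K x ^ 2) {ω : Submodule R K} (hω : IsCanonicalIdeal ω)
    (h1ω : 1 ≤ ω) (hωV : ω ≤ Rbar R K) :
    IsAlmostGorenstein R K ↔ reductionExponent (maximalIdeal R) = 2 ∧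
      ω * blowup K (maximalIdeal R) = blowup K (maximalIdeal R) := by
  have hωω := hω.div_self
  have hω0 := hω.1
  have hωfg := hω.2.1
  have hM0 := hx.frac_ne_bot
  have hM1 := frac_le_one (K := K) (maximalIdeal R)
  have hΛ1 := hx.one_le_blowup
  have hΛfg := fg_of_le Rbar_fg hx.blowup_le_Rbar
  have hγ0 : condIdeal R K ≠ ⊥ := div_ne_bot one_ne_bot Rbar_fg
  -- `ω : R̄` is the conductor
  have hωγ : ω / Rbar R K = condIdeal R K := by
    refine le_antisymm ?_ (Submodule.le_div_iff_mul_le.2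
      ((Submodule.le_div_iff_mul_le.1 le_rfl).trans h1ω))
    refine Submodule.le_div_iff_mul_le.2 ?_
    rw [← hωω, Submodule.le_div_iff_mul_le, mul_assoc]
    refine (mul_le_mul_right ?_ _).trans (Submodule.le_div_iff_mul_le.1 le_rfl)
    rw [Submodule.mul_le]
    exact fun a ha b hb => (integralClosure R K).mul_mem ha (hωV hb)
  have hVω : len (Rbar R K) ω = numTS R K := by
    rw [← hω.len_div_div hωV Rbar_fg hω0, hωω, hωγ, numTS]
  have hδ := len_add hωV h1ω Rbar_fg one_ne_bot
  have hc := len_add one_le_Rbar (condIdeal_le_one (R := R) (K := K)) Rbar_fg hγ0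
  rw [← delta] at hδ hc
  rw [← cond, ← numTS] at hc
  -- Since ℓ(V/ω) = n = c - δ, the number 2δ - c equals ℓ(ω/R).
  have hAG : IsAlmostGorenstein R K ↔
      len (dual (frac K (maximalIdeal R))) 1 = len ω 1 + 1 := by
    rw [IsAlmostGorenstein, typeSeq_one]
    omega
  have hstable : ω * blowup K (maximalIdeal R) = blowup K (maximalIdeal R) →
      (IsAlmostGorenstein R K ↔ reductionExponent (maximalIdeal R) = 2) := by
    intro h
    -- ω : Λ = ω : ωΛ = (ω : ω) : Λ = R : Λ. Duality then gives ℓ(Λ/R) = ℓ(ω/R) + ℓ(R/(R : Λ)),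
    -- where both outer lengths are known.
    have h1 : ω / blowup K (maximalIdeal R) = dual (blowup K (maximalIdeal R)) := by
      rw [← h, div_mul_eq, hωω, h, dual]
    have h2 := hω.len_div_div hΛ1 hΛfg one_ne_bot
    rw [div_one_eq, h1, len_add (C := dual (blowup K (maximalIdeal R))) h1ω
      ((div_anti_right 1 hΛ1).trans (div_one_eq 1).le) hωfg (div_ne_bot one_ne_bot hΛfg)] at h2
    have h3 := hx.len_one_dual_blowup hrat hcov
    have h4 := hx.len_blowup_one hcov
    rw [hAG]
    omega
  refine ⟨fun h => ?_, fun h => (hstable h.2).2 h.1⟩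
  suffices hs : ω * blowup K (maximalIdeal R) = blowup K (maximalIdeal R) from
    ⟨(hstable hs).1 h, hs⟩
  have hMω : frac K (maximalIdeal R) ≤ frac K (maximalIdeal R) * ω := by
    simpa using mul_le_mul_right h1ω (frac K (maximalIdeal R))
  have hMωω : frac K (maximalIdeal R) * ω ≤ ω := by
    simpa using mul_le_mul_left hM1 ω
  -- The type is the number of generators of ω. Comparing the two routes from ω to 𝔪, through 𝔪ω and
  -- through R, makes r = ℓ(ω/R) + 1 force 𝔪ω = 𝔪.
  have hr : len ω (frac K (maximalIdeal R) * ω) = len (dual (frac K (maximalIdeal R))) 1 := by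
    rw [← hω.len_div_div hMωω hωfg (ne_bot_of_le hM0 hMω), hωω, mul_comm, div_mul_eq, hωω, dual]
  have e1 := len_add hMωω hMω hωfg hM0
  have e2 := len_add h1ω hM1 hωfg hM0
  rw [len_one_frac_maximalIdeal] at e2
  rw [hAG] at h
  have hMeq : frac K (maximalIdeal R) * ω = frac K (maximalIdeal R) :=
    eq_of_len_eq_zero hMω (fg_of_le hωfg hMωω) hM0 (by omega)
  obtain ⟨n, hn⟩ : ∃ n, reductionExponent (maximalIdeal R) = n + 1 :=
    ⟨reductionExponent (maximalIdeal R) - 1, by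
      have := hx.two_le_reductionExponent hcov; omega⟩
  -- Since ν > 0, a factor N = x⁻¹𝔪 splits off Λ = N^ν, and it absorbs ω.
  rw [hx.blowup_eq_pow_reductionExponent, hn, pow_succ', ← mul_assoc]
  congr 1
  rw [scaledMax, mul_left_comm, mul_comm ω, hMeq]

end IsMinimalValue

end Final

end CurveSing

end

open CurveSing in
theorem corollary6p7
    {R : Type*} [CommRing R] [IsDomain R] [IsNoetherianRing R] [IsLocalRing R]
    (hdim : ringKrullDim R = 1)
    [Infinite (IsLocalRing.ResidueField R)]
    {K : Type*} [Field K] [Algebra R K] [IsFractionRing R K]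
    [Module.Finite R (integralClosure R K)]
    [IsDiscreteValuationRing (integralClosure R K)]
    (hrat : ResiduallyRational R K)
    (he : mult (IsLocalRing.maximalIdeal R) = (embDim R : ℤ) + 1) :
    (dual (blowup K (IsLocalRing.maximalIdeal R)) =
          frac K (IsLocalRing.maximalIdeal R) ^
            reductionExponent (IsLocalRing.maximalIdeal R) ↔
        IsGorenstein R K ∧ reductionExponent (IsLocalRing.maximalIdeal R) = 2) ∧
      (∑ i ∈ (Finset.Icc 1 (numTS R K) \ Gam K (IsLocalRing.maximalIdeal R)).erase 1,
          ((typeSeq R K i : ℤ) - 1) =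
        dInv K (IsLocalRing.maximalIdeal R) +
          (len (dual (dual (blowup K (IsLocalRing.maximalIdeal R))))
            (blowup K (IsLocalRing.maximalIdeal R)) : ℤ) +
          ((reductionExponent (IsLocalRing.maximalIdeal R) : ℤ) - 2)) ∧
      (∀ ω : Submodule R K, IsCanonicalIdeal ω → 1 ≤ ω → ω ≤ Rbar R K →
        (IsAlmostGorenstein R K ↔
          reductionExponent (IsLocalRing.maximalIdeal R) = 2 ∧
            ω * blowup K (IsLocalRing.maximalIdeal R) =
              blowup K (IsLocalRing.maximalIdeal R))) := by
  have hK : Ring.KrullDimLE 1 R := Ring.krullDimLE_iff.2 hdim.le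
  have hm : IsLocalRing.maximalIdeal R ≠ ⊥ := by
    intro h
    have h0 := ringKrullDim_eq_zero_of_isField (IsLocalRing.isField_iff_maximalIdeal_eq.2 h)
    rw [hdim] at h0
    exact one_ne_zero h0
  obtain ⟨x, hx⟩ := exists_isMinimalValue (K := K) hm
  have hcov := hx.covBy_of_mult_eq he
  exact ⟨hx.dual_blowup_eq_frac_pow_iff hrat hcov, hx.sum_typeSeq_sub_one hrat hcov,
    fun ω hω h1 h2 => hx.isAlmostGorenstein_iff hrat hcov hω h1 h2⟩
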